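/- Let $M=\Gamma\backslash G$ be a $6$-dimensional nilmanifold, i.e. the quotient of a $6$-dimensional simply connected nilpotent real Lie group $G$ by a discrete subgroup $\Gamma$ with compact quotient, and let $J$ be an invariant complex structure on $M$, i.e. an integrable almost complex structure on $M$ induced by an endomorphism of the Lie algebra of $G$ (acting on left-invariant vector fields). For an invariant Hermitian metric $g$ on $(M,J)$, i.e. one induced by an inner product on the Lie algebra of $G$ for which $J$ is orthogonal, let $\Omega$ be its fundamental $2$-form, defined by $g(X,Y)=\Omega(X,JY)$. The metric $g$ is called SKT if $$\partial\bar\partial\,\Omega=0\quad\text{and}\quad d\Omega\neq0,$$ where $\partial\bar\partial=\tfrac i2\,dJd$ on $(1,1)$-forms. Then either all invariant Hermitian metrics on $(M,J)$ are SKT or none is. Moreover, they are SKT if and only if there is a basis $(\alpha^1,\alpha^2,\alpha^3)$ of the space of invariant $(1,0)$-forms on $(M,J)$ such that $$d\alpha^1=0,\qquad d\alpha^2=0,\qquad d\alpha^3=A\,\bar\alpha^{1}\wedge\alpha^{2}+B\,\bar\alpha^{2}\wedge\alpha^{2}+C\,\alpha^{1}\wedge\bar\alpha^{1}+D\,\alpha^{1}\wedge\bar\alpha^{2}+E\,\alpha^{1}\wedge\alpha^{2},$$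 where $A,B,C,D,E$ are complex numbers, not all zero, such that $$|A|^2+|D|^2+|E|^2+2\,\mathrm{Re}(\bar B C)=0.$$ (The coefficients can all vanish only if $G$ is abelian, in which case every invariant Hermitian metric is Kähler and hence none is SKT.) -/

import Mathlib

open scoped Manifold ContDiff ComplexConjugate

noncomputable section

namespace Nilmanifold

section Forms

/-! ### Differential forms on a smooth manifold -/

variable {E : Type*} [NormedAddCommGroup E] [NormedSpace ℝ E]

variable (E) in
/-- Complex-valued differential `k`-forms (not necessarily smooth) on a manifold `M` modelled
on `E`. -/
abbrev Form (M : Type*) [TopologicalSpace M] [ChartedSpace E M] (k : ℕ) : Type _ :=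
  ∀ m : M, TangentSpace 𝓘(ℝ, E) m [⋀^Fin k]→L[ℝ] ℂ

variable {M : Type*} [TopologicalSpace M] [ChartedSpace E M]

/-- The expression of the form `η` in the preferred chart `φ` at `m`, that is, the pull-back
`(φ⁻¹)^* η`, a differential form on (an open subset of) the vector space `E`. -/
def inChart {k : ℕ} (η : Form E M k) (m : M) (e : E) : E [⋀^Fin k]→L[ℝ] ℂ :=
  (η ((extChartAt 𝓘(ℝ, E) m).symm e)).compContinuousLinearMap
    (mfderiv 𝓘(ℝ, E) 𝓘(ℝ, E) (extChartAt 𝓘(ℝ, E) m).symm e)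

/-- The exterior derivative of a differential form on a manifold: `dη = φ^* d((φ⁻¹)^* η)` at `m`,
where `φ` is the preferred chart at `m`. -/
def extDer {k : ℕ} (η : Form E M k) : Form E M (k + 1) := fun m =>
  (extDeriv (inChart η m) (extChartAt 𝓘(ℝ, E) m m)).compContinuousLinearMap
    (mfderiv 𝓘(ℝ, E) 𝓘(ℝ, E) (extChartAt 𝓘(ℝ, E) m) m)

theorem form_one_add (α : Form E M 1) (m : M) (a b : TangentSpace 𝓘(ℝ, E) m) :
    α m (fun _ => a + b) = α m (fun _ => a) + α m (fun _ => b) := by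
  have h := (α m).map_update_add (fun _ => a) 0 a b
  have hu : ∀ c : TangentSpace 𝓘(ℝ, E) m,
      Function.update (fun _ : Fin 1 => a) 0 c = fun _ => c := fun c => by
    funext i
    rw [Subsingleton.elim i 0, Function.update_self]
  rwa [hu, hu, hu] at h

theorem form_one_smul (α : Form E M 1) (m : M) (c : ℝ) (a : TangentSpace 𝓘(ℝ, E) m) :
    α m (fun _ => c • a) = c • α m (fun _ => a) := by
  have h := (α m).map_update_smul (fun _ => a) 0 c a
  have hu : ∀ c : TangentSpace 𝓘(ℝ, E) m,
      Function.update (fun _ : Fin 1 => a) 0 c = fun _ => c := fun c => by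
    funext i
    rw [Subsingleton.elim i 0, Function.update_self]
  rwa [hu, hu] at h

/-- The wedge product of two `1`-forms, `(α ∧ β)(u, v) = α(u) β(v) - α(v) β(u)`. -/
def wedge (α β : Form E M 1) : Form E M 2 := fun m =>
  { toFun := fun v => α m (fun _ => v 0) * β m (fun _ => v 1) -
      α m (fun _ => v 1) * β m (fun _ => v 0)
    map_update_add' := by
      intro _ v i x y
      fin_cases i <;> simp [form_one_add] <;> ring
    map_update_smul' := by
      intro _ v i c x
      fin_cases i <;> simp [form_one_smul] <;> ring
    cont := by
      have hα := (α m).cont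
      have hβ := (β m).cont
      have h0 : Continuous fun v : Fin 2 → TangentSpace 𝓘(ℝ, E) m => fun _ : Fin 1 => v 0 := by
        fun_prop
      have h1 : Continuous fun v : Fin 2 → TangentSpace 𝓘(ℝ, E) m => fun _ : Fin 1 => v 1 := by
        fun_prop
      exact ((hα.comp h0).mul (hβ.comp h1)).sub ((hα.comp h1).mul (hβ.comp h0))
    map_eq_zero_of_eq' := by
      intro v i j hij hne
      fin_cases i <;> fin_cases j <;> simp_all }

/-- The complex conjugate of a form. -/
def conjForm {k : ℕ} (η : Form E M k) : Form E M k := fun m =>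
  (Complex.conjCLE : ℂ →L[ℝ] ℂ).compContinuousAlternatingMap (η m)

/-- The action of an almost complex structure on forms,
`(Jη)(X₁, …, X_k) = η(JX₁, …, JX_k)`; on forms of type `(p, q)` it is multiplication by
`i ^ (p - q)`. -/
def actJ (J : ∀ m : M, TangentSpace 𝓘(ℝ, E) m →L[ℝ] TangentSpace 𝓘(ℝ, E) m) {k : ℕ}
    (η : Form E M k) : Form E M k := fun m => (η m).compContinuousLinearMap (J m)

/-- The operator `(i/2) d J d`, which for integrable `J` is `∂∂̄` on forms of type `(p, p)`. -/
def ddbar (J : ∀ m : M, TangentSpace 𝓘(ℝ, E) m →L[ℝ] TangentSpace 𝓘(ℝ, E) m) {k : ℕ}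
    (η : Form E M k) : Form E M (k + 1 + 1) :=
  (Complex.I / 2) • extDer (actJ J (extDer η))

/-- Integrability of an almost complex structure: the Nijenhuis tensor
`[JX, JY] - J[JX, Y] - J[X, JY] - [X, Y]` vanishes. -/
def IsIntegrable [IsManifold 𝓘(ℝ, E) ∞ M]
    (J : ∀ m : M, TangentSpace 𝓘(ℝ, E) m →L[ℝ] TangentSpace 𝓘(ℝ, E) m) : Prop :=
  ∀ X Y : ∀ m : M, TangentSpace 𝓘(ℝ, E) m,
    ContMDiff 𝓘(ℝ, E) 𝓘(ℝ, E).tangent 1 (fun m => (⟨m, X m⟩ : TangentBundle 𝓘(ℝ, E) M)) →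
    ContMDiff 𝓘(ℝ, E) 𝓘(ℝ, E).tangent 1 (fun m => (⟨m, Y m⟩ : TangentBundle 𝓘(ℝ, E) M)) →
    ∀ m, VectorField.mlieBracket 𝓘(ℝ, E) (fun p => J p (X p)) (fun p => J p (Y p)) m
      - J m (VectorField.mlieBracket 𝓘(ℝ, E) (fun p => J p (X p)) Y m)
      - J m (VectorField.mlieBracket 𝓘(ℝ, E) X (fun p => J p (Y p)) m)
      - VectorField.mlieBracket 𝓘(ℝ, E) X Y m = 0

end Forms

section Quotients

/-! ### Nilmanifolds and invariant structures -/

/-- The set `Γ\G` of orbits of left multiplication by `Γ` on `G`, with the quotient topology. -/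
abbrev OrbitSpace {G : Type*} [Group G] (Γ : Subgroup G) : Type _ :=
  Quotient (QuotientGroup.rightRel Γ)

/-- The projection `G → Γ\G`. -/
def proj {G : Type*} [Group G] (Γ : Subgroup G) : G → OrbitSpace Γ :=
  Quotient.mk (QuotientGroup.rightRel Γ)

variable {E : Type*} [NormedAddCommGroup E] [NormedSpace ℝ E]
  {G : Type*} [TopologicalSpace G] [ChartedSpace E G] [Group G]

/-- A smooth Lie group has the smoothness that is needed for its Lie algebra. -/
instance [LieGroup 𝓘(ℝ, E) ∞ G] : LieGroup 𝓘(ℝ, E) (minSmoothness ℝ 3) G :=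
  LieGroup.of_le (n := ∞) (by
    rw [minSmoothness_of_isRCLikeNormedField]
    exact WithTop.coe_le_coe.2 (le_top (a := (3 : ℕ∞))))

variable (E) in
/-- `Γ\G` is a nilmanifold: `G` is a nilpotent simply connected Lie group and `Γ` is a discrete
subgroup with compact quotient; the smooth structure of `Γ\G` is the quotient one, that is, the
one for which the projection is a local diffeomorphism. -/
structure IsNilmanifold [CompleteSpace E] [LieGroup 𝓘(ℝ, E) ∞ G] (Γ : Subgroup G) [ChartedSpace E (OrbitSpace Γ)]
    [IsManifold 𝓘(ℝ, E) ∞ (OrbitSpace Γ)] : Prop where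
  simplyConnected : SimplyConnectedSpace G
  nilpotent : LieRing.IsNilpotent (GroupLieAlgebra 𝓘(ℝ, E) G)
  discrete : DiscreteTopology Γ
  compact : CompactSpace (OrbitSpace Γ)
  localDiffeomorph : IsLocalDiffeomorph 𝓘(ℝ, E) 𝓘(ℝ, E) ∞ (proj Γ)

variable (Γ : Subgroup G) [ChartedSpace E (OrbitSpace Γ)]

/-- The image in `Γ\G`, at the point `Γx`, of the left-invariant vector field on `G` that is
determined by the element `v` of the Lie algebra. -/
def invField (v : GroupLieAlgebra 𝓘(ℝ, E) G) (x : G) : TangentSpace 𝓘(ℝ, E) (proj Γ x) :=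
  mfderiv 𝓘(ℝ, E) 𝓘(ℝ, E) (proj Γ) x (mulInvariantVectorField v x)

variable (E) in
/-- An invariant complex structure on `Γ\G`: an integrable almost complex structure that is
induced by an endomorphism `J₀` of the Lie algebra of `G`. -/
structure InvariantComplexStructure [IsManifold 𝓘(ℝ, E) ∞ (OrbitSpace Γ)] where
  /-- The almost complex structure. -/
  J : ∀ m : OrbitSpace Γ, TangentSpace 𝓘(ℝ, E) m →L[ℝ] TangentSpace 𝓘(ℝ, E) m
  sq_eq_neg : ∀ m u, J m (J m u) = -u
  invariant : ∃ J₀ : GroupLieAlgebra 𝓘(ℝ, E) G →ₗ[ℝ] GroupLieAlgebra 𝓘(ℝ, E) G,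
    ∀ x v, J (proj Γ x) (invField Γ v x) = invField Γ (J₀ v) x
  integrable : IsIntegrable J

variable {Γ} [IsManifold 𝓘(ℝ, E) ∞ (OrbitSpace Γ)]

/-- An invariant Hermitian metric on `(Γ\G, J)`: a Riemannian metric for which `J` is orthogonal
and that is constant on pairs of left-invariant vector fields. -/
structure InvariantHermitianMetric (S : InvariantComplexStructure E Γ) where
  /-- The metric. -/
  g : ∀ m : OrbitSpace Γ,
    TangentSpace 𝓘(ℝ, E) m →L[ℝ] TangentSpace 𝓘(ℝ, E) m →L[ℝ] ℝ
  symm : ∀ m u v, g m u v = g m v u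
  pos : ∀ m u, u ≠ 0 → 0 < g m u u
  hermitian : ∀ m u v, g m (S.J m u) (S.J m v) = g m u v
  invariant : ∃ g₀ : GroupLieAlgebra 𝓘(ℝ, E) G → GroupLieAlgebra 𝓘(ℝ, E) G → ℝ,
    ∀ x v w, g (proj Γ x) (invField Γ v x) (invField Γ w x) = g₀ v w

namespace InvariantHermitianMetric

variable {S : InvariantComplexStructure E Γ}

theorem g_J_self (h : InvariantHermitianMetric S) (m : OrbitSpace Γ)
    (u : TangentSpace 𝓘(ℝ, E) m) : h.g m (S.J m u) u = 0 := by
  have h1 := h.hermitian m (S.J m u) u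
  rw [S.sq_eq_neg, map_neg, neg_apply, h.symm m u] at h1
  linarith

/-- The fundamental `2`-form `Ω(X, Y) = g(JX, Y)`, equivalently `g(X, Y) = Ω(X, JY)`. -/
def fundForm (h : InvariantHermitianMetric S) : Form E (OrbitSpace Γ) 2 := fun m =>
  { toFun := fun v => ((h.g m (S.J m (v 0)) (v 1) : ℝ) : ℂ)
    map_update_add' := by
      intro _ v i x y
      fin_cases i <;> simp
    map_update_smul' := by
      intro _ v i c x
      fin_cases i <;> simp
    cont := by
      refine Complex.continuous_ofReal.comp ?_
      let b : E →L[ℝ] E →L[ℝ] ℝ := h.g m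
      let j : E →L[ℝ] E := S.J m
      have h1 : Continuous fun v : Fin 2 → E => b (j (v 0)) (v 1) := by fun_prop
      exact h1
    map_eq_zero_of_eq' := by
      intro v i j hij hne
      have h0 : v 0 = v 1 := by
        fin_cases i <;> fin_cases j <;> simp_all
      rw [← h0, h.g_J_self m (v 0), Complex.ofReal_zero] }

theorem g_eq_fundForm (h : InvariantHermitianMetric S) (m : OrbitSpace Γ)
    (u v : TangentSpace 𝓘(ℝ, E) m) : (h.g m u v : ℂ) = h.fundForm m ![u, S.J m v] := by
  change (h.g m u v : ℂ) = ((h.g m (S.J m u) (S.J m v) : ℝ) : ℂ)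
  rw [h.hermitian]

/-- The (strict) SKT condition: `∂∂̄Ω = 0` but `dΩ ≠ 0`. -/
def IsSKT (h : InvariantHermitianMetric S) : Prop :=
  ddbar S.J h.fundForm = 0 ∧ extDer h.fundForm ≠ 0

end InvariantHermitianMetric

/-- The complex vector space of invariant forms of type `(1, 0)` on `(Γ\G, J)`. -/
def InvariantComplexStructure.oneZeroForms (S : InvariantComplexStructure E Γ) :
    Submodule ℂ (Form E (OrbitSpace Γ) 1) where
  carrier := {α | (∀ m u, α m ![S.J m u] = Complex.I * α m ![u]) ∧
    ∃ a : GroupLieAlgebra 𝓘(ℝ, E) G → ℂ, ∀ x v, α (proj Γ x) ![invField Γ v x] = a v}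
  zero_mem' := ⟨by simp, 0, by simp⟩
  add_mem' := by
    rintro α β ⟨hα, a, ha⟩ ⟨hβ, b, hb⟩
    exact ⟨by simp [hα, hβ, mul_add], a + b, by simp [ha, hb]⟩
  smul_mem' := by
    rintro c α ⟨hα, a, ha⟩
    exact ⟨by simp [hα, mul_left_comm], c • a, by simp [ha]⟩

end Quotients

end Nilmanifold

end

/-! A form with constant coefficients in the left-invariant frame of Γ\G is differentiated by Lie
brackets alone (`isLieFrame_invFrame`, `extDer_apply_frame`). Hence every condition becomes one on
the Lie algebra L of G, which J makes a complex vector space of dimension 3.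

The core is that an SKT metric forces [L, L] into a complex line whose elements are central
(`exists_central_complex_line`). On suitable quadruples (a, Ja, b, Jb) the form dJdΩ collapses to
minus a sum of squared lengths of brackets, so its vanishing kills these brackets; nilpotency
supplies the vectors. One such quadruple shows that Jx is central whenever x is
(`lie_I_smul_eq_zero_of_central`). If the brackets do not all lie in ℂx for the chosen central x, a
second one shows that r = [y, Jy] spans the required line for a suitable y.

Once [L, L] ⊆ ℂp with ℂp central, dα³ is a 2-form on L/ℂp ≅ ℂ², and integrability removes its ᾱ¹∧ᾱ²
component; five coefficients A, ..., E remain (`exists_structureEq_of_central_complex_line`). Then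
dJdΩ is, up to normalization, |p|² (|A|² + |D|² + |E|² + 2 Re(B̄C)) α¹ᾱ¹α²ᾱ²
(`StructureEq.dTorsion_eq`), so the metric enters only through the positive factor |p|². Moreover dΩ
= 0 only if all brackets vanish (`StructureEq.dFund_eq_zero_iff`). This gives both the dichotomy and
the criterion; for the converse a metric exists because a complex basis can be declared unitary. -/

noncomputable section

namespace Nilmanifold

/-! ### Frames of vector fields closed under bracket, read in charts -/

section Frames

variable {E : Type*} [NormedAddCommGroup E] [NormedSpace ℝ E]
  {M : Type*} [TopologicalSpace M] [ChartedSpace E M]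
  {L : Type*} [LieRing L] [LieAlgebra ℝ L]

/-- A parallelism of `M` by `C^1` vector fields that are indexed by a Lie algebra and whose
Lie brackets are given by the bracket of the Lie algebra. -/
structure IsLieFrame [IsManifold 𝓘(ℝ, E) ∞ M]
    (X : ∀ m : M, L ≃ₗ[ℝ] TangentSpace 𝓘(ℝ, E) m) : Prop where
  smooth : ∀ v, ContMDiff 𝓘(ℝ, E) 𝓘(ℝ, E).tangent 1
    (fun m => (⟨m, X m v⟩ : TangentBundle 𝓘(ℝ, E) M))
  bracket : ∀ v w m, VectorField.mlieBracket 𝓘(ℝ, E) (fun p => X p v) (fun p => X p w) m =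
    X m ⁅v, w⁆

/-- The vector field of the frame that belongs to `v`, read in the preferred chart at `m`. -/
def frameInChart (X : ∀ m : M, L ≃ₗ[ℝ] TangentSpace 𝓘(ℝ, E) m) (m : M) (v : L) (e : E) : E :=
  (mfderiv 𝓘(ℝ, E) 𝓘(ℝ, E) (extChartAt 𝓘(ℝ, E) m).symm e).inverse
    (X ((extChartAt 𝓘(ℝ, E) m).symm e) v)

theorem frameInChart_eq_mpullbackWithin (X : ∀ m : M, L ≃ₗ[ℝ] TangentSpace 𝓘(ℝ, E) m) (m : M)
    (v : L) :
    frameInChart X m v = VectorField.mpullbackWithin 𝓘(ℝ, E) 𝓘(ℝ, E)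
      (extChartAt 𝓘(ℝ, E) m).symm (fun p => X p v) (Set.range 𝓘(ℝ, E)) := by
  have hr : Set.range 𝓘(ℝ, E) = Set.univ := by simp
  rw [hr, VectorField.mpullbackWithin_univ]
  rfl

variable [IsManifold 𝓘(ℝ, E) ∞ M] {X : ∀ m : M, L ≃ₗ[ℝ] TangentSpace 𝓘(ℝ, E) m}

instance isManifold_two : IsManifold 𝓘(ℝ, E) 2 M := IsManifold.of_le (n := ∞) (by norm_cast)
instance isManifold_minSmoothness_two : IsManifold 𝓘(ℝ, E) (minSmoothness ℝ 2) M := by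
  rw [minSmoothness_of_isRCLikeNormedField]; infer_instance

theorem isInvertible_mfderiv_extChartAt_symm {m : M} {e : E}
    (he : e ∈ (extChartAt 𝓘(ℝ, E) m).target) :
    (mfderiv 𝓘(ℝ, E) 𝓘(ℝ, E) (extChartAt 𝓘(ℝ, E) m).symm e).IsInvertible := by
  have := isInvertible_mfderivWithin_extChartAt_symm (I := 𝓘(ℝ, E)) he
  simpa using this

/-- The derivative of the preferred chart at `m`. -/
def chartDeriv (m : M) : TangentSpace 𝓘(ℝ, E) m →L[ℝ] E :=
  mfderiv 𝓘(ℝ, E) 𝓘(ℝ, E) (extChartAt 𝓘(ℝ, E) m) m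

theorem isInvertible_chartDeriv (m : M) : (chartDeriv (E := E) m).IsInvertible :=
  isInvertible_mfderiv_extChartAt (I := 𝓘(ℝ, E)) (mem_extChartAt_source (I := 𝓘(ℝ, E)) m)

theorem chartDeriv_inverse_frameInChart (m : M) (v : L) :
    (chartDeriv m).inverse (frameInChart X m v (extChartAt 𝓘(ℝ, E) m m)) = X m v := by
  have h := VectorField.mfderiv_extChartAt_inverse_comp_mfderivWithin_extChartAT_symm
    (I := 𝓘(ℝ, E)) (x := m) (X m v)
  have hr : Set.range 𝓘(ℝ, E) = Set.univ := by simp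
  rw [hr, mfderivWithin_univ] at h
  refine Eq.trans ?_ h
  -- The point φ⁻¹(φ(m)) equals m only propositionally, so both tangent spaces are read as E and the
  -- equality is transported.
  have key : ∀ p : M, p = m → ∀ B : E →L[ℝ] E,
      (B ((X p v : TangentSpace 𝓘(ℝ, E) p) : E) : E) = B ((X m v : TangentSpace 𝓘(ℝ, E) m) : E) := by
    rintro _ rfl B; rfl
  exact congrArg _ (key _ (extChartAt_to_inv (I := 𝓘(ℝ, E)) m) _)

theorem frameInChart_self (m : M) (v : L) :
    frameInChart X m v (extChartAt 𝓘(ℝ, E) m m) = chartDeriv m (X m v) := by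
  rw [← chartDeriv_inverse_frameInChart, (isInvertible_chartDeriv m).self_apply_inverse]

theorem differentiableAt_frameInChart [CompleteSpace E] (hX : IsLieFrame X) (m : M) (v : L) :
    DifferentiableAt ℝ (frameInChart X m v) (extChartAt 𝓘(ℝ, E) m m) := by
  have h := MDifferentiableWithinAt.differentiableWithinAt_mpullbackWithin_vectorField
    (s := Set.univ)
    (((hX.smooth v).mdifferentiable (by norm_num) m).mdifferentiableWithinAt)
  have hr : (extChartAt 𝓘(ℝ, E) m).symm ⁻¹' Set.univ ∩ Set.range 𝓘(ℝ, E) = Set.univ := by simp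
  rw [hr] at h
  rw [frameInChart_eq_mpullbackWithin]
  exact differentiableWithinAt_univ.1 h

/-- The bracket on the manifold is the chart bracket pulled back by the derivative of the chart;
applying that derivative recovers the chart bracket. -/
theorem lieBracket_frameInChart (hX : IsLieFrame X) (m : M) (v w : L) :
    VectorField.lieBracket ℝ (frameInChart X m v) (frameInChart X m w) (extChartAt 𝓘(ℝ, E) m m) =
      frameInChart X m ⁅v, w⁆ (extChartAt 𝓘(ℝ, E) m m) := by
  have h := hX.bracket v w m
  have hr : (extChartAt 𝓘(ℝ, E) m).symm ⁻¹' Set.univ ∩ Set.range 𝓘(ℝ, E) = Set.univ := by simp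
  rw [← VectorField.mlieBracketWithin_univ, VectorField.mlieBracketWithin_apply, hr,
    ← frameInChart_eq_mpullbackWithin, ← frameInChart_eq_mpullbackWithin] at h
  rw [frameInChart_self, ← h, ← VectorField.lieBracketWithin_univ]
  exact ((isInvertible_chartDeriv m).self_apply_inverse _).symm

end Frames

/-! ### Exterior derivative of forms with constant coefficients in a frame -/

section FrameForms

variable {E : Type*} [NormedAddCommGroup E] [NormedSpace ℝ E]
  {M : Type*} [TopologicalSpace M] [ChartedSpace E M]
  {L : Type*} [LieRing L] [LieAlgebra ℝ L]
  {X : ∀ m : M, L ≃ₗ[ℝ] TangentSpace 𝓘(ℝ, E) m}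

theorem eventually_mem_extChartAt_target (m : M) :
    ∀ᶠ e in nhds (extChartAt 𝓘(ℝ, E) m m), e ∈ (extChartAt 𝓘(ℝ, E) m).target :=
  extChartAt_target_mem_nhds m

theorem frameInChart_add (m : M) (v w : L) (e : E) :
    frameInChart X m (v + w) e = frameInChart X m v e + frameInChart X m w e :=
  (congrArg _ (map_add (X _) v w)).trans (map_add _ _ _)

theorem frameInChart_smul (m : M) (c : ℝ) (v : L) (e : E) :
    frameInChart X m (c • v) e = c • frameInChart X m v e :=
  (congrArg _ (map_smul (X _) c v)).trans (map_smul _ c _)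

variable [IsManifold 𝓘(ℝ, E) ∞ M]

theorem inChart_apply_frameInChart {k : ℕ} {η : Form E M k} {a : (Fin k → L) → ℂ}
    (h : ∀ m v, η m (fun i => X m (v i)) = a v) {m : M} {e : E}
    (he : e ∈ (extChartAt 𝓘(ℝ, E) m).target) (v : Fin k → L) :
    inChart η m e (fun i => frameInChart X m (v i) e) = a v := by
  rw [← h ((extChartAt 𝓘(ℝ, E) m).symm e) v]
  refine congrArg (η ((extChartAt 𝓘(ℝ, E) m).symm e)) (funext fun i => ?_)
  exact (isInvertible_mfderiv_extChartAt_symm he).self_apply_inverse _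

theorem bijective_frameInChart {m : M} {e : E} (he : e ∈ (extChartAt 𝓘(ℝ, E) m).target) :
    Function.Bijective fun v : L => frameInChart X m v e :=
  (isInvertible_mfderiv_extChartAt_symm he).inverse.bijective.comp (X _).bijective

variable [FiniteDimensional ℝ E]

/-- The frame in the preferred chart at `m`, relative to the frame at `m`. -/
def frameMap (X : ∀ m : M, L ≃ₗ[ℝ] TangentSpace 𝓘(ℝ, E) m) (m : M) (e : E) : E →L[ℝ] E :=
  ∑ j, (LinearMap.toContinuousLinearMap ((Module.finBasis ℝ E).coord j)).smulRight
    (frameInChart X m ((X m).symm (Module.finBasis ℝ E j)) e)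

theorem frameMap_apply (m : M) (e u : E) :
    frameMap X m e u = frameInChart X m ((X m).symm u) e := by
  let f : E →ₗ[ℝ] E :=
    { toFun := fun u => frameInChart X m ((X m).symm u) e
      map_add' := fun u v => by
        rw [← frameInChart_add]; exact congrArg (frameInChart X m · e) (map_add (X m).symm u v)
      map_smul' := fun c u => by
        rw [RingHom.id_apply, ← frameInChart_smul]
        exact congrArg (frameInChart X m · e) (map_smul (X m).symm c u) }
  have h : (frameMap X m e : E →ₗ[ℝ] E) = f := by
    refine (Module.finBasis ℝ E).ext fun i => ?_
    simp [frameMap, f, Finsupp.single_apply]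
  exact congrArg (fun g : E →ₗ[ℝ] E => g u) h

theorem isInvertible_frameMap {m : M} {e : E} (he : e ∈ (extChartAt 𝓘(ℝ, E) m).target) :
    (frameMap X m e).IsInvertible := by
  have hb : Function.Bijective (frameMap X m e) := by
    have : (frameMap X m e : E → E) = (fun v : L => frameInChart X m v e) ∘ (X m).symm :=
      funext fun u => frameMap_apply m e u
    rw [this]
    exact (bijective_frameInChart he).comp (X m).symm.bijective
  exact ⟨(LinearEquiv.ofBijective (frameMap X m e : E →ₗ[ℝ] E) hb).toContinuousLinearEquiv,
    by ext; rfl⟩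

theorem differentiableAt_frameMap (hX : IsLieFrame X) (m : M) :
    DifferentiableAt ℝ (frameMap X m) (extChartAt 𝓘(ℝ, E) m m) := by
  have : CompleteSpace E := FiniteDimensional.complete ℝ E
  unfold frameMap
  refine DifferentiableAt.fun_sum fun j _ => ?_
  exact ((ContinuousLinearMap.smulRightL ℝ E E
    (LinearMap.toContinuousLinearMap ((Module.finBasis ℝ E).coord j))).differentiableAt).comp _
    (differentiableAt_frameInChart hX m _)

/-- Since η has the same coefficients in the frame at every point, its dependence on e sits entirely
in the coframe, the inverse of `frameMap`. -/
theorem inChart_eq_compContinuousLinearMap {k : ℕ} {η : Form E M k} {a : (Fin k → L) → ℂ}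
    (h : ∀ m v, η m (fun i => X m (v i)) = a v) {m : M} {e : E}
    (he : e ∈ (extChartAt 𝓘(ℝ, E) m).target) :
    inChart η m e = ContinuousAlternatingMap.compContinuousLinearMap
      (η m : E [⋀^Fin k]→L[ℝ] ℂ) (frameMap X m e).inverse := by
  ext u
  have hi := isInvertible_frameMap (X := X) he
  obtain ⟨w, rfl⟩ : ∃ w : Fin k → E, u = fun i => frameMap X m e (w i) :=
    ⟨fun i => (frameMap X m e).inverse (u i), funext fun i => (hi.self_apply_inverse _).symm⟩
  have h1 := inChart_apply_frameInChart h he (fun i => (X m).symm (w i))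
  have h2 : η m w = a (fun i => (X m).symm (w i)) := by
    rw [← h m]
    exact congrArg (η m) (funext fun i => ((X m).apply_symm_apply (w i)).symm)
  have h3 : (fun i => frameMap X m e (w i)) = fun i => frameInChart X m ((X m).symm (w i)) e :=
    funext fun i => frameMap_apply m e (w i)
  rw [h3, h1, ← h2, ← h3]
  exact congrArg (η m) (funext fun i => (hi.inverse_apply_self (w i)).symm)

/-- Regularity of η comes from that of the frame: the frame is C¹ and inversion of operators is
smooth at an invertible one. -/
theorem differentiableAt_inChart (hX : IsLieFrame X) {k : ℕ} {η : Form E M k}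
    {a : (Fin k → L) → ℂ} (h : ∀ m v, η m (fun i => X m (v i)) = a v) (m : M) :
    DifferentiableAt ℝ (inChart η m) (extChartAt 𝓘(ℝ, E) m m) := by
  have : CompleteSpace E := FiniteDimensional.complete ℝ E
  have he : inChart η m =ᶠ[nhds (extChartAt 𝓘(ℝ, E) m m)] fun e =>
      ContinuousAlternatingMap.compContinuousLinearMap
        (η m : E [⋀^Fin k]→L[ℝ] ℂ) (frameMap X m e).inverse :=
    (eventually_mem_extChartAt_target m).mono fun e he => inChart_eq_compContinuousLinearMap h he
  refine DifferentiableAt.congr_of_eventuallyEq ?_ he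
  have hi : DifferentiableAt ℝ (fun e => (frameMap X m e).inverse)
      (extChartAt 𝓘(ℝ, E) m m) := by
    obtain ⟨f, hf⟩ := isInvertible_frameMap (X := X) (mem_extChartAt_target (I := 𝓘(ℝ, E)) m)
    have h1 : DifferentiableAt ℝ ContinuousLinearMap.inverse
        (frameMap X m (extChartAt 𝓘(ℝ, E) m m)) := by
      rw [← hf]
      exact (contDiffAt_map_inverse (n := 1) f).differentiableAt (by norm_num)
    exact h1.comp _ (differentiableAt_frameMap hX m)
  exact ((hasFDerivAt_const _ _).continuousAlternatingMapCompContinuousLinearMap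
    hi.hasFDerivAt).differentiableAt

/-- The exterior derivative of a form with constant coefficients with respect to a frame whose
Lie brackets are those of a Lie algebra. -/
theorem extDer_apply_frame (hX : IsLieFrame X) {n : ℕ} {η : Form E M (n + 1)}
    {a : (Fin (n + 1) → L) → ℂ} (h : ∀ m v, η m (fun i => X m (v i)) = a v) (m : M)
    (v : Fin (n + 2) → L) :
    extDer η m (fun i => X m (v i)) =
      -∑ i : Fin (n + 1), ∑ j ≥ i, (-1) ^ (i + j : ℕ) •
        a (Matrix.vecCons ⁅v i.castSucc, v j.succ⁆ (j.removeNth (i.castSucc.removeNth v))) := by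
  have : CompleteSpace E := FiniteDimensional.complete ℝ E
  have h1 : extDer η m (fun i => X m (v i)) = extDeriv (inChart η m) (extChartAt 𝓘(ℝ, E) m m)
      (fun i => frameInChart X m (v i) (extChartAt 𝓘(ℝ, E) m m)) := by
    simp only [frameInChart_self]
    rfl
  rw [h1, extDeriv_apply_vectorField (V := fun i => frameInChart X m (v i))
    (differentiableAt_inChart hX h m) fun i => differentiableAt_frameInChart hX m (v i)]
  -- In the invariant formula for d the directional-derivative terms vanish, because η is constant
  -- on frame fields near the base point; only the bracket terms survive.
  have h2 : ∀ i : Fin (n + 2), fderiv ℝ (fun e => inChart η m e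
      (i.removeNth fun j => frameInChart X m (v j) e)) (extChartAt 𝓘(ℝ, E) m m) = 0 := by
    intro i
    have : (fun e => inChart η m e (i.removeNth fun j => frameInChart X m (v j) e))
        =ᶠ[nhds (extChartAt 𝓘(ℝ, E) m m)] fun _ => a (i.removeNth v) :=
      (eventually_mem_extChartAt_target m).mono fun e he =>
        inChart_apply_frameInChart h he (i.removeNth v)
    rw [this.fderiv_eq, fderiv_fun_const]
    rfl
  simp only [h2, zero_apply, smul_zero, Finset.sum_const_zero, zero_sub]
  refine congrArg _ (Finset.sum_congr rfl fun i _ => Finset.sum_congr rfl fun j _ => ?_)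
  refine congrArg _ ?_
  rw [lieBracket_frameInChart hX,
    ← inChart_apply_frameInChart h (mem_extChartAt_target (I := 𝓘(ℝ, E)) m)]
  refine congrArg _ (funext fun l => ?_)
  refine Fin.cases rfl (fun l => rfl) l

end FrameForms

/-! ### The left-invariant frame on Γ\G -/

section QuotientFrame

set_option linter.unusedSectionVars false

variable {E : Type*} [NormedAddCommGroup E] [NormedSpace ℝ E]
  {G : Type*} [Group G] {Γ : Subgroup G}

theorem proj_surjective : Function.Surjective (proj Γ) := Quotient.mk_surjective

theorem proj_eq_proj_iff {x y : G} : proj Γ x = proj Γ y ↔ y * x⁻¹ ∈ Γ :=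
  Quotient.eq.trans QuotientGroup.rightRel_apply

theorem proj_mul {γ : G} (hγ : γ ∈ Γ) (x : G) : proj Γ (γ * x) = proj Γ x :=
  (proj_eq_proj_iff.2 (by simpa using hγ)).symm

variable [TopologicalSpace G] [ChartedSpace E G] [ChartedSpace E (OrbitSpace Γ)]
  [LieGroup 𝓘(ℝ, E) ∞ G]

theorem mulInvariantVectorField_mul (v : GroupLieAlgebra 𝓘(ℝ, E) G) (g x : G) :
    mulInvariantVectorField v (g * x) =
      mfderiv 𝓘(ℝ, E) 𝓘(ℝ, E) (g * ·) x (mulInvariantVectorField v x) := by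
  have hd : ∀ h y : G, MDifferentiableAt 𝓘(ℝ, E) 𝓘(ℝ, E) (h * ·) y := fun h y =>
    (contMDiff_mul_left (I := 𝓘(ℝ, E)) (n := ∞) (a := h)).mdifferentiable (by simp) y
  have h1 : (fun y => g * x * y) = (g * ·) ∘ (x * ·) := by
    funext y; simp [mul_assoc]
  unfold mulInvariantVectorField
  rw [h1, mfderiv_comp_of_eq (y := x) (hd g x) (hd x 1) (mul_one x)]
  have key : ∀ p : G, p = x → ∀ u : E,
      (mfderiv 𝓘(ℝ, E) 𝓘(ℝ, E) (g * ·) p : E →L[ℝ] E) u =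
      (mfderiv 𝓘(ℝ, E) 𝓘(ℝ, E) (g * ·) x : E →L[ℝ] E) u := by
    rintro _ rfl u; rfl
  exact key _ (mul_one x) _

theorem isInvertible_mfderiv_mul_left (g x : G) :
    (mfderiv 𝓘(ℝ, E) 𝓘(ℝ, E) (g * ·) x).IsInvertible := by
  let Φ : Diffeomorph 𝓘(ℝ, E) 𝓘(ℝ, E) G G ∞ :=
    { Equiv.mulLeft g with
      contMDiff_toFun := contMDiff_mul_left
      contMDiff_invFun := contMDiff_mul_left }
  exact ⟨Φ.mfderivToContinuousLinearEquiv (by simp) x, rfl⟩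

/-- Differentiate π ∘ L_γ = π and use left invariance. This is why left-invariant fields descend to
Γ\G. -/
theorem invField_mul (hπ : IsLocalDiffeomorph 𝓘(ℝ, E) 𝓘(ℝ, E) ∞ (proj Γ)) {γ : G} (hγ : γ ∈ Γ)
    (v : GroupLieAlgebra 𝓘(ℝ, E) G) (x : G) :
    (invField Γ v (γ * x) : E) = (invField Γ v x : E) := by
  have h1 : proj Γ ∘ (γ * ·) = proj Γ := funext fun y => proj_mul hγ y
  have hd : MDifferentiableAt 𝓘(ℝ, E) 𝓘(ℝ, E) (γ * ·) x :=
    (contMDiff_mul_left (I := 𝓘(ℝ, E)) (n := ∞) (a := γ)).mdifferentiable (by simp) x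
  have hp := hπ.mdifferentiable (by simp) (γ * x)
  have h2 := mfderiv_comp x hp hd
  have key : ∀ f : G → OrbitSpace Γ, f = proj Γ → ∀ u : E,
      (mfderiv 𝓘(ℝ, E) 𝓘(ℝ, E) f x : E →L[ℝ] E) u =
      (mfderiv 𝓘(ℝ, E) 𝓘(ℝ, E) (proj Γ) x : E →L[ℝ] E) u := by
    rintro _ rfl u; rfl
  have h3 := congrArg (fun A : E →L[ℝ] E => A (mulInvariantVectorField v x : E)) h2
  exact (congrArg (mfderiv 𝓘(ℝ, E) 𝓘(ℝ, E) (proj Γ) (γ * x))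
    (mulInvariantVectorField_mul v γ x)).trans (h3.symm.trans (key _ h1 _))

theorem invField_eq_of_proj_eq (hπ : IsLocalDiffeomorph 𝓘(ℝ, E) 𝓘(ℝ, E) ∞ (proj Γ)) {x y : G}
    (h : proj Γ x = proj Γ y) (v : GroupLieAlgebra 𝓘(ℝ, E) G) :
    (invField Γ v x : E) = (invField Γ v y : E) := by
  have := invField_mul hπ (proj_eq_proj_iff.1 h) v x
  rw [inv_mul_cancel_right] at this
  exact this.symm

variable [CompleteSpace E]

theorem bijective_invField (hπ : IsLocalDiffeomorph 𝓘(ℝ, E) 𝓘(ℝ, E) ∞ (proj Γ)) (x : G) :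
    Function.Bijective fun v : GroupLieAlgebra 𝓘(ℝ, E) G => invField Γ v x :=
  ((hπ x).mfderivToContinuousLinearEquiv (by simp)).bijective.comp
    (isInvertible_mfderiv_mul_left x 1).bijective

/-- The left-invariant vector fields as linear isomorphisms from the Lie algebra of `G` to the
tangent spaces of `Γ\G`. -/
def invFrame (hπ : IsLocalDiffeomorph 𝓘(ℝ, E) 𝓘(ℝ, E) ∞ (proj Γ)) (m : OrbitSpace Γ) :
    GroupLieAlgebra 𝓘(ℝ, E) G ≃ₗ[ℝ] TangentSpace 𝓘(ℝ, E) m :=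
  LinearEquiv.ofBijective
    { toFun := fun v => (invField Γ v m.out : E)
      map_add' := fun v w => by
        unfold invField
        rw [mulInvariantVectorField_add]
        exact map_add (mfderiv 𝓘(ℝ, E) 𝓘(ℝ, E) (proj Γ) m.out) _ _
      map_smul' := fun c v => by
        unfold invField
        rw [mulInvariantVectorField_smul]
        exact map_smul (mfderiv 𝓘(ℝ, E) 𝓘(ℝ, E) (proj Γ) m.out) c _ }
    (bijective_invField hπ m.out)

theorem invFrame_proj (hπ : IsLocalDiffeomorph 𝓘(ℝ, E) 𝓘(ℝ, E) ∞ (proj Γ)) (x : G)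
    (v : GroupLieAlgebra 𝓘(ℝ, E) G) : invFrame hπ (proj Γ x) v = invField Γ v x :=
  invField_eq_of_proj_eq hπ (Quotient.out_eq (proj Γ x)) v

/-- The frame is defined through arbitrary representatives `m.out`; this local description by a
smooth section of π gives its smoothness and its brackets. -/
theorem invFrame_eventuallyEq (hπ : IsLocalDiffeomorph 𝓘(ℝ, E) 𝓘(ℝ, E) ∞ (proj Γ)) (x : G)
    (v : GroupLieAlgebra 𝓘(ℝ, E) G) :
    (fun p => invFrame hπ p v) =ᶠ[nhds (proj Γ x)]
      VectorField.mpullback 𝓘(ℝ, E) 𝓘(ℝ, E) (hπ x).localInverse (mulInvariantVectorField v) := by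
  filter_upwards [(hπ x).localInverse_open_source.mem_nhds (hπ x).localInverse_mem_source]
    with p hp
  have hy : proj Γ ((hπ x).localInverse p) = p := (hπ x).localInverse_right_inv hp
  have ht : (hπ x).localInverse p ∈ (hπ x).localInverse.target :=
    (hπ x).localInverse.map_source hp
  have hinv : (mfderiv 𝓘(ℝ, E) 𝓘(ℝ, E) (hπ x).localInverse p).IsInvertible :=
    ⟨((hπ x).localInverse.isLocalDiffeomorphAt _ _ _ hp).mfderivToContinuousLinearEquiv (by simp),
      rfl⟩
  have hσ : MDifferentiableAt 𝓘(ℝ, E) 𝓘(ℝ, E) (hπ x).localInverse p :=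
    (hπ x).localInverse.mdifferentiableAt (by simp) hp
  generalize hyy : (hπ x).localInverse p = y at hy ht
  have hid : (hπ x).localInverse ∘ proj Γ =ᶠ[nhds y] id :=
    Filter.eventuallyEq_of_mem ((hπ x).localInverse.open_target.mem_nhds ht)
      (hπ x).localInverse_eqOn_left
  have hc := mfderiv_comp_of_eq hσ (hπ.mdifferentiable (by simp) y) hy
  rw [hid.mfderiv_eq, mfderiv_id] at hc
  have h1 := congrArg (fun A : E →L[ℝ] E => A (mulInvariantVectorField v y : E)) hc
  have h2 : (mfderiv 𝓘(ℝ, E) 𝓘(ℝ, E) (hπ x).localInverse p) (invField Γ v y : E) =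
      (mulInvariantVectorField v ((hπ x).localInverse p) : E) := by
    have key : ∀ z : G, z = y →
        (mulInvariantVectorField v y : E) = (mulInvariantVectorField v z : E) := by
      rintro _ rfl; rfl
    subst hy
    exact h1.symm.trans (key _ hyy)
  have h3 : (invFrame hπ p v : E) = (invField Γ v y : E) := by
    subst hy
    exact invFrame_proj hπ y v
  rw [VectorField.mpullback_apply]
  refine h3.trans ?_
  exact (hinv.inverse_apply_eq.2 h2.symm).symm

variable [IsManifold 𝓘(ℝ, E) ∞ (OrbitSpace Γ)]

theorem isLieFrame_invFrame (hπ : IsLocalDiffeomorph 𝓘(ℝ, E) 𝓘(ℝ, E) ∞ (proj Γ)) :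
    IsLieFrame (invFrame hπ) where
  smooth v := by
    intro m
    obtain ⟨x, rfl⟩ := proj_surjective m
    have hinv : (mfderiv 𝓘(ℝ, E) 𝓘(ℝ, E) (hπ x).localInverse (proj Γ x)).IsInvertible :=
      ⟨(hπ x).localInverse_isLocalDiffeomorphAt.mfderivToContinuousLinearEquiv (by simp), rfl⟩
    have h1 : ContMDiffAt 𝓘(ℝ, E) 𝓘(ℝ, E).tangent 1
        (fun g : G => (⟨g, mulInvariantVectorField v g⟩ : TangentBundle 𝓘(ℝ, E) G))
        ((hπ x).localInverse (proj Γ x)) :=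
      (contMDiffAt_mulInvariantVectorField v).of_le (by
        rw [minSmoothness_of_isRCLikeNormedField]; norm_num)
    have h2 := ContMDiffAt.mpullback_vectorField_preimage h1
      ((hπ x).localInverse_contMDiffAt.of_le (n := ∞) (m := 2) (by norm_cast)) hinv (by norm_num)
    refine h2.congr_of_eventuallyEq ((invFrame_eventuallyEq hπ x v).mono fun p hp => ?_)
    exact congrArg (Bundle.TotalSpace.mk p) hp
  bracket v w m := by
    obtain ⟨x, rfl⟩ := proj_surjective m
    rw [(invFrame_eventuallyEq hπ x v).mlieBracket_vectorField_eq (invFrame_eventuallyEq hπ x w),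
      ← VectorField.mpullback_mlieBracket (n := ∞) (mdifferentiableAt_mulInvariantVectorField v)
        (mdifferentiableAt_mulInvariantVectorField w) (hπ x).localInverse_contMDiffAt
        (by rw [minSmoothness_of_isRCLikeNormedField]; norm_cast),
      ← mulInvariantVector_mlieBracket]
    exact (invFrame_eventuallyEq hπ x ⁅v, w⁆).self_of_nhds.symm

end QuotientFrame

/-! ### Nilpotent Lie algebras with integrable J; the centre is J-stable -/

section ComplexLie

set_option linter.unusedSectionVars false

open Complex (I)

variable {L : Type*} [LieRing L] [LieAlgebra ℝ L]

/-- Take x in the last term of the lower central series that is not contained in W. -/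
theorem exists_notMem_forall_lie_mem [LieRing.IsNilpotent L] {W : Submodule ℝ L} (hW : W ≠ ⊤) :
    ∃ x ∉ W, ∀ y : L, ⁅y, x⁆ ∈ W := by
  classical
  obtain ⟨k, hk⟩ := (LieModule.isNilpotent_iff ℝ L L).1 inferInstance
  have hex : ∃ k, (LieModule.lowerCentralSeries ℝ L L k : Submodule ℝ L) ≤ W :=
    ⟨k, by rw [hk]; simp⟩
  have hspec := Nat.find_spec hex
  rcases hn : Nat.find hex with _ | n
  · rw [hn] at hspec
    exact absurd (top_le_iff.1 (by simpa using hspec)) hW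
  · rw [hn] at hspec
    have hlt : ¬ (LieModule.lowerCentralSeries ℝ L L n : Submodule ℝ L) ≤ W :=
      Nat.find_min hex (by omega)
    obtain ⟨x, hx, hxW⟩ := SetLike.not_le_iff_exists.1 hlt
    refine ⟨x, hxW, fun y => hspec ?_⟩
    rw [LieModule.lowerCentralSeries_succ]
    exact LieSubmodule.lie_mem_lie (LieSubmodule.mem_top y) hx

/-- The nilpotent map ad y induces a nilpotent endomorphism of L/W, whose only eigenvalue is 0. -/
theorem eq_zero_of_lie_sub_smul_mem [LieRing.IsNilpotent L] {W : Submodule ℝ L} {y u : L} {c : ℝ}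
    (hW : ∀ w ∈ W, ⁅y, w⁆ ∈ W) (hu : u ∉ W) (h : ⁅y, u⁆ - c • u ∈ W) : c = 0 := by
  obtain ⟨n, hn⟩ := LieModule.isNilpotent_toEnd_of_isNilpotent ℝ L L y
  have key : ∀ k : ℕ, ((LieModule.toEnd ℝ L L y) ^ k) u - c ^ k • u ∈ W := by
    intro k
    induction k with
    | zero => simp
    | succ k ih =>
      have h1 := W.add_mem (hW _ ih) (W.smul_mem (c ^ k) h)
      rw [pow_succ', Module.End.mul_apply, LieModule.toEnd_apply_apply]
      convert h1 using 1
      rw [lie_sub, lie_smul, smul_sub, smul_smul, pow_succ]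
      abel
  have h1 := key n
  rw [hn, LinearMap.zero_apply, zero_sub, W.neg_mem_iff] at h1
  by_contra hc
  exact hu ((W.smul_mem_iff (pow_ne_zero n hc)).1 h1)

variable [Module ℂ L]

/-- The vanishing of the Nijenhuis tensor of the multiplication by `I` on a Lie algebra. -/
def IsIntegrableLie (L : Type*) [LieRing L] [Module ℂ L] : Prop :=
  ∀ u v : L, ⁅I • u, I • v⁆ - I • ⁅I • u, v⁆ - I • ⁅u, I • v⁆ - ⁅u, v⁆ = 0

theorem IsIntegrableLie.lie_I_smul_I_smul (hN : IsIntegrableLie L) (u v : L) :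
    ⁅I • u, I • v⁆ = I • ⁅I • u, v⁆ + I • ⁅u, I • v⁆ + ⁅u, v⁆ := by
  rw [← sub_eq_zero, ← hN u v]; abel

theorem I_smul_I_smul (v : L) : I • I • v = -v := by
  rw [smul_smul, Complex.I_mul_I, neg_one_smul]

/-- Inner products for which the multiplication by `I` is orthogonal. -/
structure IsHermitianForm (g : L →ₗ[ℝ] L →ₗ[ℝ] ℝ) : Prop where
  symm : ∀ u v, g u v = g v u
  pos : ∀ u, u ≠ 0 → 0 < g u u
  herm : ∀ u v, g (I • u) (I • v) = g u v

theorem IsHermitianForm.I_smul_self {g : L →ₗ[ℝ] L →ₗ[ℝ] ℝ} (hg : IsHermitianForm g) (u : L) :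
    g (I • u) u = 0 := by
  have h := hg.herm (I • u) u
  rw [I_smul_I_smul, map_neg, LinearMap.neg_apply, hg.symm u] at h
  linarith

theorem IsHermitianForm.I_smul_left {g : L →ₗ[ℝ] L →ₗ[ℝ] ℝ} (hg : IsHermitianForm g) (u v : L) :
    g (I • u) v = -g u (I • v) := by
  rw [← hg.herm (I • u) v, I_smul_I_smul, map_neg, LinearMap.neg_apply]

theorem IsHermitianForm.eq_zero {g : L →ₗ[ℝ] L →ₗ[ℝ] ℝ} (hg : IsHermitianForm g) {u : L}
    (h : g u u ≤ 0) : u = 0 := by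
  by_contra hu
  exact absurd (hg.pos u hu) (not_lt.2 h)

/-- The values of `J dΩ` on left-invariant vector fields. -/
def torsion (g : L →ₗ[ℝ] L →ₗ[ℝ] ℝ) (a b c : L) : ℝ :=
  -g ⁅I • a, I • b⁆ c + g ⁅I • a, I • c⁆ b - g ⁅I • b, I • c⁆ a

/-- The values of `d J dΩ` on left-invariant vector fields. -/
def dTorsion (g : L →ₗ[ℝ] L →ₗ[ℝ] ℝ) (a b c d : L) : ℝ :=
  -torsion g ⁅a, b⁆ c d + torsion g ⁅a, c⁆ b d - torsion g ⁅a, d⁆ b c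
    - torsion g ⁅b, c⁆ a d + torsion g ⁅b, d⁆ a c - torsion g ⁅c, d⁆ a b

/-- The centre of a nilpotent Lie algebra with a strong torsion metric is complex. -/
theorem lie_I_smul_eq_zero_of_central [LieRing.IsNilpotent L] (hN : IsIntegrableLie L)
    {g : L →ₗ[ℝ] L →ₗ[ℝ] ℝ} (hg : IsHermitianForm g) (hT : ∀ a b c d, dTorsion g a b c d = 0)
    {x : L} (hx : ∀ y : L, ⁅x, y⁆ = 0) (y : L) : ⁅I • x, y⁆ = 0 := by
  let W : Submodule ℝ L := LinearMap.ker (LieAlgebra.ad ℝ L (I • x) : L →ₗ[ℝ] L)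
  have hmem : ∀ v, v ∈ W ↔ ⁅I • x, v⁆ = 0 := fun v => by simp [W]
  suffices hW : W = ⊤ from (hmem y).1 (hW ▸ Submodule.mem_top)
  by_contra hW
  obtain ⟨y, hy, hL⟩ := exists_notMem_forall_lie_mem hW
  rw [hmem] at hy
  have hx' : ∀ v : L, ⁅v, x⁆ = 0 := fun v => by rw [← lie_skew, hx, neg_zero]
  -- For central x, integrability says that ad(Ix) is complex linear.
  have hJ : ∀ v, ⁅I • x, I • v⁆ = I • ⁅I • x, v⁆ := fun v => by
    rw [hN.lie_I_smul_I_smul, hx, hx]; simp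
  have hJ' : ∀ v, ⁅I • v, I • x⁆ = I • ⁅v, I • x⁆ := fun v => by
    rw [← lie_skew (I • v) (I • x), hJ, ← lie_skew v (I • x), smul_neg]
  set u := ⁅I • x, y⁆ with hu
  have hu2 : ⁅I • x, u⁆ = 0 := (hmem _).1 (hL _)
  have hu2' : ⁅u, I • x⁆ = 0 := by rw [← lie_skew, hu2, neg_zero]
  have h1 : ⁅I • x, ⁅y, I • y⁆⁆ = 0 := by
    rw [← lie_skew y, lie_neg, (hmem _).1 (hL _), neg_zero]
  have h1' : ⁅⁅y, I • y⁆, I • x⁆ = 0 := by rw [← lie_skew, h1, neg_zero]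
  -- The Jacobi identity for ad(Ix) on [y, Iy], which ad(Ix) annihilates.
  have h2 : ⁅I • u, y⁆ = ⁅u, I • y⁆ := by
    have := leibniz_lie (I • x) y (I • y)
    rw [h1, hJ, ← hu, ← lie_skew y (I • u)] at this
    exact (sub_eq_zero.1 (by rw [sub_eq_add_neg]; exact this.symm)).symm
  -- By the relations above this value equals -2 g(u, u), contradicting u ≠ 0.
  have h := hT x (I • x) y (I • y)
  have hpos := hg.pos u hy
  have hI := hg.herm u u
  simp only [dTorsion, torsion, hx, hx', hJ, hJ', I_smul_I_smul, neg_lie, lie_neg,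
    smul_zero, zero_lie, map_neg, map_zero, LinearMap.neg_apply, LinearMap.zero_apply,
    ← hu, hu2', h1', h2, hI] at h
  linarith

end ComplexLie

/-! ### Commutators lie in a central complex line -/

section ComplexLieStructure

set_option linter.unusedSectionVars false

open Complex (I)

variable {L : Type*} [LieRing L] [LieAlgebra ℝ L] [Module ℂ L] [IsScalarTower ℝ ℂ L]

theorem smul_eq_re_smul_add_im_smul (a : ℂ) (v : L) : a • v = a.re • v + a.im • I • v := by
  rw [← algebraMap_smul ℂ a.re v, ← algebraMap_smul ℂ a.im (I • v), smul_smul, ← add_smul]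
  congr 1
  exact (Complex.re_add_im a).symm

/-- A real subspace of a complex space of dimension three is everything as soon as it contains
three complex lines in general position. -/
theorem submodule_eq_top_of_three_lines (h3 : Module.finrank ℂ L = 3) {x y z : L} (hx : x ≠ 0)
    (hy : y ∉ Submodule.span ℂ {x}) (hz : z ∉ Submodule.span ℂ {y, x}) {W : Submodule ℝ L}
    (hW : ∀ v, v = x ∨ v = y ∨ v = z → v ∈ W ∧ I • v ∈ W) : W = ⊤ := by
  have hfd : FiniteDimensional ℂ L := Module.finite_of_finrank_pos (by omega)
  have hli : LinearIndependent ℂ ![z, y, x] := by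
    refine linearIndependent_finCons.2 ⟨linearIndependent_finCons.2
      ⟨linearIndependent_finCons.2 ⟨linearIndependent_empty_type, ?_⟩, ?_⟩, ?_⟩
    · simpa using hx
    · simpa using hy
    · simpa [Set.pair_comm] using hz
  have hspan := hli.span_eq_top_of_card_eq_finrank' (by simp [h3])
  have hsm : ∀ (a : ℂ) v, (v ∈ W ∧ I • v ∈ W) → a • v ∈ W := fun a v h => by
    rw [smul_eq_re_smul_add_im_smul]
    exact W.add_mem (W.smul_mem _ h.1) (W.smul_mem _ h.2)
  refine (Submodule.eq_top_iff'.2 fun v => ?_)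
  have hv : v ∈ Submodule.span ℂ (Set.range ![z, y, x]) := hspan ▸ Submodule.mem_top
  obtain ⟨c, rfl⟩ := (Submodule.mem_span_range_iff_exists_fun ℂ).1 hv
  rw [Fin.sum_univ_three]
  exact W.add_mem (W.add_mem (hsm _ _ (hW _ (by simp))) (hsm _ _ (hW _ (by simp))))
    (hsm _ _ (hW _ (by simp)))

/-- The bracket is an element of the subspace `V` if it is one on generators. -/
def lieInto (V : Submodule ℝ L) (u : L) : Submodule ℝ L :=
  V.comap (LieAlgebra.ad ℝ L u : L →ₗ[ℝ] L)

theorem mem_lieInto {V : Submodule ℝ L} {u v : L} : v ∈ lieInto V u ↔ ⁅u, v⁆ ∈ V := by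
  simp [lieInto]

/-- The elements whose brackets with all elements are in the subspace `V`. -/
def centralMod (V : Submodule ℝ L) : Submodule ℝ L := ⨅ v, lieInto V v

theorem mem_centralMod {V : Submodule ℝ L} {u : L} : u ∈ centralMod V ↔ ∀ v : L, ⁅u, v⁆ ∈ V := by
  simp only [centralMod, Submodule.mem_iInf, mem_lieInto]
  exact forall_congr' fun v => by rw [← lie_skew, V.neg_mem_iff]

theorem mem_centralMod' {V : Submodule ℝ L} {u : L} : u ∈ centralMod V ↔ ∀ v : L, ⁅v, u⁆ ∈ V := by
  simp only [centralMod, Submodule.mem_iInf, mem_lieInto]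

/-- An integrable nilpotent complex structure with a strong torsion metric in six dimensions has
its commutators in a complex line that is central. -/
theorem exists_central_complex_line [LieRing.IsNilpotent L] (h3 : Module.finrank ℂ L = 3)
    (hN : IsIntegrableLie L)
    {g : L →ₗ[ℝ] L →ₗ[ℝ] ℝ} (hg : IsHermitianForm g) (hT : ∀ a b c d, dTorsion g a b c d = 0) :
    ∃ p : L, p ≠ 0 ∧ (∀ v : L, ⁅p, v⁆ = 0) ∧ (∀ v : L, ⁅I • p, v⁆ = 0) ∧
      ∀ u v : L, ⁅u, v⁆ ∈ Submodule.span ℂ {p} := by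
  have hfd : FiniteDimensional ℂ L := Module.finite_of_finrank_pos (by omega)
  have hnt : Nontrivial L := Module.nontrivial_of_finrank_pos (R := ℂ) (by omega)
  obtain ⟨x, hx0, hx⟩ := exists_notMem_forall_lie_mem (L := L) (W := ⊥) bot_ne_top
  rw [Submodule.mem_bot] at hx0
  have hxc : ∀ v : L, ⁅x, v⁆ = 0 := fun v => by
    rw [← lie_skew, (Submodule.mem_bot ℝ).1 (hx v), neg_zero]
  have hIx : ∀ v : L, ⁅I • x, v⁆ = 0 := lie_I_smul_eq_zero_of_central hN hg hT hxc
  have hxc' : ∀ v : L, ⁅v, x⁆ = 0 := fun v => by rw [← lie_skew, hxc, neg_zero]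
  have hIx' : ∀ v : L, ⁅v, I • x⁆ = 0 := fun v => by rw [← lie_skew, hIx, neg_zero]
  let V : Submodule ℝ L := (Submodule.span ℂ {x}).restrictScalars ℝ
  have hxV : x ∈ V := Submodule.mem_span_singleton_self x
  have hIV : ∀ {v}, v ∈ V → I • v ∈ V := fun h => Submodule.smul_mem (Submodule.span ℂ {x}) I h
  have hVc : ∀ {v}, v ∈ V → ∀ w : L, ⁅v, w⁆ = 0 := by
    intro v hv w
    obtain ⟨a, rfl⟩ := Submodule.mem_span_singleton.1 hv
    rw [smul_eq_re_smul_add_im_smul, add_lie, smul_lie, smul_lie, hxc, hIx, smul_zero, smul_zero,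
      add_zero]
  have hVc' : ∀ {v}, v ∈ V → ∀ w : L, ⁅w, v⁆ = 0 := fun h w => by
    rw [← lie_skew, hVc h, neg_zero]
  by_cases hab : ∀ u v : L, ⁅u, v⁆ ∈ V
  · exact ⟨x, hx0, hxc, hIx, hab⟩
  have hVtop : V ≠ ⊤ := fun h => hab fun u v => h ▸ Submodule.mem_top
  -- The choices x, x', y are adapted to nilpotency: x is central, x' is central modulo V = ℂx, and
  -- y is central modulo V2 = ℂx + ℂx'.
  obtain ⟨x', hx'V, hx'L⟩ := exists_notMem_forall_lie_mem hVtop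
  let V2 : Submodule ℝ L := (Submodule.span ℂ {x', x}).restrictScalars ℝ
  have hV2top : V2 ≠ ⊤ := by
    intro h
    have h1 : Submodule.span ℂ {x', x} = (⊤ : Submodule ℂ L) :=
      Submodule.eq_top_iff'.2 fun v => (h ▸ Submodule.mem_top : v ∈ V2)
    classical
    have h2 := finrank_span_finset_le_card (R := ℂ) ({x', x} : Finset L)
    rw [Finset.coe_pair, Set.finrank, h1, finrank_top, h3] at h2
    have h4 : ({x', x} : Finset L).card ≤ 2 := Finset.card_le_two
    omega
  obtain ⟨y, hyV2, hyL⟩ := exists_notMem_forall_lie_mem hV2top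
  have hspan : ∀ {W : Submodule ℝ L},
      (∀ v, v = x ∨ v = x' ∨ v = y → v ∈ W ∧ I • v ∈ W) → W = ⊤ := fun h =>
    submodule_eq_top_of_three_lines h3 hx0 hx'V hyV2 h
  have hV2mem : ∀ {v}, v ∈ V2 → ∃ a : ℂ, v - a • x' ∈ V := by
    intro v hv
    obtain ⟨a, b, rfl⟩ := Submodule.mem_span_pair.1 hv
    exact ⟨a, by rw [add_sub_cancel_left]; exact Submodule.smul_mem _ b hxV⟩
  have hx'1 : x' ∈ centralMod V := mem_centralMod'.2 hx'L
  have hV1 : ∀ {v}, v ∈ V → v ∈ centralMod V := fun h => mem_centralMod.2 fun w => by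
    rw [hVc h]; exact V.zero_mem
  -- an argument with eigenvalues modulo `V + ℝ x'`
  have heig : ∀ (w : L) (a : ℂ), ⁅w, I • x'⁆ - a • x' ∈ V → a.im = 0 := by
    intro w a h
    let W : Submodule ℝ L := V ⊔ Submodule.span ℝ {x'}
    refine eq_zero_of_lie_sub_smul_mem (y := w) (W := W) (u := I • x') ?_ ?_ ?_
    · intro v hv
      refine Submodule.mem_sup_left ?_
      have : W ≤ centralMod V := sup_le (fun v hv => hV1 hv) (by
        rw [Submodule.span_le, Set.singleton_subset_iff]; exact hx'1)
      exact mem_centralMod'.1 (this hv) w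
    · intro hmem
      obtain ⟨v, hv, t, ht, h1⟩ := Submodule.mem_sup.1 hmem
      obtain ⟨c, rfl⟩ := Submodule.mem_span_singleton.1 ht
      have h2 : (I - c : ℂ) • x' ∈ V := by
        rw [sub_smul, ← h1, ← Complex.coe_algebraMap, algebraMap_smul, add_sub_cancel_right]
        exact hv
      have hc : (I - c : ℂ) ≠ 0 := fun h => by simpa using congrArg Complex.im h
      exact hx'V ((Submodule.smul_mem_iff (Submodule.span ℂ {x}) hc).1 h2)
    · rw [smul_eq_re_smul_add_im_smul a, ← sub_sub, sub_right_comm] at h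
      have h1 := W.add_mem (Submodule.mem_sup_left h) (Submodule.mem_sup_right
        (Submodule.smul_mem _ a.re (Submodule.mem_span_singleton_self x')))
      rwa [sub_add_cancel] at h1
  -- Modulo V, [y, Ix'] is a x', and integrability makes [Iy, Ix'] equal to (Ia) x'. The eigenvalue
  -- argument, applied to both, kills Im a and Im(Ia) = Re a, so Ix' is central modulo V as well.
  obtain ⟨a, ha⟩ := hV2mem (V2.neg_mem (hyL (I • x')))
  rw [lie_skew] at ha
  have ha' : ⁅I • y, I • x'⁆ - (I * a) • x' ∈ V := by
    rw [hN.lie_I_smul_I_smul]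
    have h1 := V.add_mem (V.add_mem (hIV (hx'L (I • y))) (hIV ha)) (hx'L y)
    convert h1 using 1
    rw [smul_sub, smul_smul]
    abel
  have ha0 : a = 0 := Complex.ext (by simpa using heig _ _ ha') (heig _ _ ha)
  rw [ha0, zero_smul, sub_zero] at ha
  rw [ha0, mul_zero, zero_smul, sub_zero] at ha'
  have hIx'1 : I • x' ∈ centralMod V := by
    rw [mem_centralMod]
    suffices lieInto V (I • x') = ⊤ from fun v => mem_lieInto.1 (this ▸ Submodule.mem_top)
    refine hspan ?_
    simp only [mem_lieInto]
    rintro v (rfl | rfl | rfl)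
    · rw [hxc', hIx']; exact ⟨V.zero_mem, V.zero_mem⟩
    · rw [lie_self]; exact ⟨hx'L _, V.zero_mem⟩
    · rw [← lie_skew, ← lie_skew (I • x')]; exact ⟨V.neg_mem ha, V.neg_mem ha'⟩
  have hV2c : ∀ {v}, v ∈ V2 → v ∈ centralMod V := by
    intro v hv
    obtain ⟨c, hc⟩ := hV2mem hv
    have h1 := Submodule.add_mem _ (hV1 hc) (Submodule.add_mem _
      (Submodule.smul_mem _ c.re hx'1) (Submodule.smul_mem _ c.im hIx'1))
    rwa [← smul_eq_re_smul_add_im_smul, sub_add_cancel] at h1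
  set r := ⁅y, I • y⁆ with hr
  have hrV2 : r ∈ V2 := by
    have := V2.neg_mem (hyL (I • y))
    rwa [lie_skew] at this
  have hIrV2 : I • r ∈ V2 := Submodule.smul_mem (Submodule.span ℂ {x', x}) I hrV2
  have hyx' : ∀ z : L, ⁅z, x'⁆ ∈ V ∧ ⁅z, I • x'⁆ ∈ V := fun z =>
    ⟨hx'L z, mem_centralMod'.1 hIx'1 z⟩
  have hxz : ∀ (W : Submodule ℝ L) (z : L), ⁅z, x⁆ ∈ W ∧ ⁅z, I • x⁆ ∈ W := fun W z => by
    rw [hxc', hIx']; exact ⟨W.zero_mem, W.zero_mem⟩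
  -- Modulo V, r is the only bracket of the spanning vectors that can be nonzero; were it in V, all
  -- brackets would be.
  by_cases hrV : r ∈ V
  · refine absurd ?_ hab
    suffices centralMod V = ⊤ from fun u v => mem_centralMod.1 (this ▸ Submodule.mem_top) v
    have hr' : ⁅I • y, y⁆ ∈ V := by rw [← lie_skew]; exact V.neg_mem hrV
    refine hspan ?_
    rintro v (rfl | rfl | rfl)
    · exact ⟨hV1 hxV, hV1 (hIV hxV)⟩
    · exact ⟨hx'1, hIx'1⟩
    · constructor <;> refine mem_centralMod.2 fun u => ?_
      · suffices lieInto V v = ⊤ from mem_lieInto.1 (this ▸ Submodule.mem_top)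
        refine hspan ?_
        simp only [mem_lieInto]
        rintro u (rfl | rfl | rfl)
        · exact hxz V _
        · exact hyx' _
        · rw [lie_self]; exact ⟨V.zero_mem, hrV⟩
      · suffices lieInto V (I • v) = ⊤ from mem_lieInto.1 (this ▸ Submodule.mem_top)
        refine hspan ?_
        simp only [mem_lieInto]
        rintro u (rfl | rfl | rfl)
        · exact hxz V _
        · exact hyx' _
        · rw [lie_self]; exact ⟨hr', V.zero_mem⟩
  have hrc : ∀ v : L, ⁅r, v⁆ ∈ V := mem_centralMod.1 (hV2c hrV2)
  have hIrc : ∀ v : L, ⁅I • r, v⁆ ∈ V := mem_centralMod.1 (hV2c hIrV2)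
  -- As r = [y, Iy], Jacobi expresses this bracket through brackets with elements of the central
  -- line V.
  have hrIr : ⁅r, I • r⁆ = 0 := by
    have h1 : ∀ v : L, ⁅v, I • r⁆ ∈ V := mem_centralMod'.1 (hV2c hIrV2)
    have h2 : ⁅r, I • r⁆ = ⁅y, ⁅I • y, I • r⁆⁆ - ⁅I • y, ⁅y, I • r⁆⁆ := lie_lie y (I • y) (I • r)
    rw [h2, hVc' (h1 _), hVc' (h1 _), sub_zero]
  -- the component of `r` that is orthogonal to the central line `V`
  have hgx : g x x ≠ 0 := (hg.pos x hx0).ne'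
  let a' : ℂ := ⟨g r x / g x x, g r (I • x) / g x x⟩
  obtain ⟨w, hw⟩ : ∃ w, w = r - a' • x := ⟨_, rfl⟩
  have haV : a' • x ∈ V := Submodule.smul_mem (Submodule.span ℂ {x}) _ hxV
  have hwlie : ∀ v : L, ⁅w, v⁆ = ⁅r, v⁆ := fun v => by rw [hw, sub_lie, hVc haV, sub_zero]
  have hIwlie : ∀ v : L, ⁅I • w, v⁆ = ⁅I • r, v⁆ := fun v => by
    rw [hw, smul_sub, sub_lie, hVc (hIV haV), sub_zero]
  have hlieIw : ∀ v : L, ⁅v, I • w⁆ = ⁅v, I • r⁆ := fun v => by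
    rw [← lie_skew, hIwlie, lie_skew]
  have hxIx : g x (I • x) = 0 := by rw [hg.symm]; exact hg.I_smul_self x
  have hwx : g w x = 0 ∧ g w (I • x) = 0 := by
    rw [hw, smul_eq_re_smul_add_im_smul]
    simp only [map_sub, map_add, map_smul, LinearMap.sub_apply, LinearMap.add_apply,
      LinearMap.smul_apply, hxIx, hg.I_smul_self, hg.herm, smul_eq_mul, a']
    constructor <;> field_simp <;> ring
  have hwV : ∀ {v}, v ∈ V → g w v = 0 := by
    intro v hv
    obtain ⟨c, rfl⟩ := Submodule.mem_span_singleton.1 hv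
    rw [smul_eq_re_smul_add_im_smul, map_add, map_smul, map_smul, hwx.1, hwx.2]
    simp
  have hVw : ∀ {v}, v ∈ V → g v w = 0 ∧ g v (I • w) = 0 := fun hv =>
    ⟨by rw [hg.symm]; exact hwV hv, by
      rw [hg.symm, hg.I_smul_left, hwV (hIV hv), neg_zero]⟩
  have hTV : ∀ {v}, v ∈ V → ∀ c d, torsion g v c d = -g ⁅I • c, I • d⁆ v := fun hv c d => by
    simp [torsion, hVc (hIV hv)]
  -- The vectors w and Iw have the same brackets as r and Ir. On (w, Iw, y, Iy) the outer terms
  -- vanish, and each of the four mixed terms is minus a squared length, because the brackets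
  -- involved are in the central line V.
  have hsq : g ⁅r, y⁆ ⁅r, y⁆ + g ⁅r, I • y⁆ ⁅r, I • y⁆ + g ⁅I • r, y⁆ ⁅I • r, y⁆ +
      g ⁅I • r, I • y⁆ ⁅I • r, I • y⁆ = 0 := by
    have h := hT w (I • w) y (I • y)
    have h6 : torsion g r w (I • w) = 0 := by
      have e2 : ⁅I • r, w⁆ = 0 := by rw [← lie_skew, hwlie, hrIr, neg_zero]
      have e3 : ⁅I • w, w⁆ = 0 := by rw [hIwlie, e2]
      simp [torsion, I_smul_I_smul, hlieIw, e2, e3]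
    rw [dTorsion, ← hr, h6, hwlie, hwlie, hwlie, hIwlie, hIwlie, hTV (hrc _), hTV (hrc _),
      hTV (hrc _), hTV (hIrc _), hTV (hIrc _)] at h
    have e0 : ⁅r, I • w⁆ = 0 := by rw [hlieIw, hrIr]
    simp only [I_smul_I_smul, neg_lie, lie_neg, map_neg, LinearMap.neg_apply, hwlie, hIwlie, e0,
      map_zero] at h
    linarith
  have hnn : ∀ v, 0 ≤ g v v := fun v => by
    by_cases hv : v = 0
    · simp [hv]
    · exact (hg.pos v hv).le
  have h1 : ⁅r, y⁆ = 0 := hg.eq_zero (by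
    linarith [hnn ⁅r, I • y⁆, hnn ⁅I • r, y⁆, hnn ⁅I • r, I • y⁆])
  have h2 : ⁅r, I • y⁆ = 0 := hg.eq_zero (by
    linarith [hnn ⁅r, y⁆, hnn ⁅I • r, y⁆, hnn ⁅I • r, I • y⁆])
  have h4 : ⁅I • r, y⁆ = 0 := hg.eq_zero (by
    linarith [hnn ⁅r, y⁆, hnn ⁅r, I • y⁆, hnn ⁅I • r, I • y⁆])
  have h5 : ⁅I • r, I • y⁆ = 0 := hg.eq_zero (by
    linarith [hnn ⁅r, y⁆, hnn ⁅r, I • y⁆, hnn ⁅I • r, y⁆])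
  have hyr : y ∉ Submodule.span ℂ {r, x} := fun h => hyV2 <| by
    refine (Submodule.span_le (p := Submodule.span ℂ {x', x})).2 ?_ h
    rintro v (rfl | rfl)
    · exact hrV2
    · exact Submodule.subset_span (by simp)
  have hspan' : ∀ {W : Submodule ℝ L},
      (∀ v, v = x ∨ v = r ∨ v = y → v ∈ W ∧ I • v ∈ W) → W = ⊤ := fun h =>
    submodule_eq_top_of_three_lines h3 hx0 hrV hyr h
  have hIrr : ⁅I • r, r⁆ = 0 := by rw [← lie_skew, hrIr, neg_zero]
  have hrz : ∀ v : L, ⁅r, v⁆ = 0 := fun v => by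
    suffices lieInto ⊥ r = ⊤ from (Submodule.mem_bot ℝ).1 (mem_lieInto.1 (this ▸ Submodule.mem_top))
    refine hspan' ?_
    simp only [mem_lieInto, Submodule.mem_bot]
    rintro v (rfl | rfl | rfl)
    · exact ⟨hxc' _, hIx' _⟩
    · exact ⟨lie_self _, hrIr⟩
    · exact ⟨h1, h2⟩
  have hIrz : ∀ v : L, ⁅I • r, v⁆ = 0 := fun v => by
    suffices lieInto ⊥ (I • r) = ⊤ from
      (Submodule.mem_bot ℝ).1 (mem_lieInto.1 (this ▸ Submodule.mem_top))
    refine hspan' ?_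
    simp only [mem_lieInto, Submodule.mem_bot]
    rintro v (rfl | rfl | rfl)
    · exact ⟨hxc' _, hIx' _⟩
    · exact ⟨hIrr, lie_self _⟩
    · exact ⟨h4, h5⟩
  have hrz' : ∀ v : L, ⁅v, r⁆ = 0 := fun v => by rw [← lie_skew, hrz, neg_zero]
  have hIrz' : ∀ v : L, ⁅v, I • r⁆ = 0 := fun v => by rw [← lie_skew, hIrz, neg_zero]
  -- Now x, r and their I-multiples are central, and x, r, y span L over ℂ, so every bracket is a
  -- multiple of [y, Iy] = r.
  refine ⟨r, fun h => hrV (h ▸ V.zero_mem), hrz, hIrz, ?_⟩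
  let U : Submodule ℝ L := (Submodule.span ℂ {r}).restrictScalars ℝ
  have hrU : r ∈ U := Submodule.mem_span_singleton_self r
  have hr' : ⁅I • y, y⁆ ∈ U := by rw [← lie_skew]; exact U.neg_mem hrU
  suffices centralMod U = ⊤ from fun u v =>
    (mem_centralMod.1 (this ▸ Submodule.mem_top) v : ⁅u, v⁆ ∈ U)
  refine hspan' ?_
  simp only [mem_centralMod]
  rintro v (hv | hv | hv)
  · subst hv
    exact ⟨fun u => by rw [hxc]; exact U.zero_mem, fun u => by rw [hIx]; exact U.zero_mem⟩
  · subst hv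
    exact ⟨fun u => by rw [hrz]; exact U.zero_mem, fun u => by rw [hIrz]; exact U.zero_mem⟩
  · rw [hv]
    constructor <;> intro u
    · suffices lieInto U y = ⊤ from mem_lieInto.1 (this ▸ Submodule.mem_top)
      refine hspan' ?_
      simp only [mem_lieInto]
      rintro u (hu | hu | hu) <;> rw [hu]
      · exact hxz U _
      · rw [hrz', hIrz']; exact ⟨U.zero_mem, U.zero_mem⟩
      · rw [lie_self]; exact ⟨U.zero_mem, hrU⟩
    · suffices lieInto U (I • y) = ⊤ from mem_lieInto.1 (this ▸ Submodule.mem_top)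
      refine hspan' ?_
      simp only [mem_lieInto]
      rintro u (hu | hu | hu) <;> rw [hu]
      · exact hxz U _
      · rw [hrz', hIrz']; exact ⟨U.zero_mem, U.zero_mem⟩
      · rw [lie_self]; exact ⟨hr', U.zero_mem⟩

end ComplexLieStructure

/-! ### Structure equations from a central complex line -/

section StructureEquations

open Complex (I)

variable {L : Type*} [LieRing L] [LieAlgebra ℝ L] [Module ℂ L]

/-- The value at `(u, v)` of the 2-form `A ᾱ¹α² + B ᾱ²α² + C α¹ᾱ¹ + D α¹ᾱ² + E α¹α²`, where
`u` and `v` are given by their coordinates. -/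
def structForm (A B C D E : ℂ) (u v : ℂ × ℂ) : ℂ :=
  A * (conj u.1 * v.2 - conj v.1 * u.2) + B * (conj u.2 * v.2 - conj v.2 * u.2) +
    C * (u.1 * conj v.1 - v.1 * conj u.1) + D * (u.1 * conj v.2 - v.1 * conj u.2) +
    E * (u.1 * v.2 - v.1 * u.2)

/-- The first two coordinates of a vector. -/
def coordPair (b : Module.Basis (Fin 3) ℂ L) (u : L) : ℂ × ℂ := (b.coord 0 u, b.coord 1 u)

/-- The structure equations of a Lie algebra in a complex basis. -/
def StructureEq (b : Module.Basis (Fin 3) ℂ L) (A B C D E : ℂ) : Prop :=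
  ∀ u v : L, b.coord 0 ⁅u, v⁆ = 0 ∧ b.coord 1 ⁅u, v⁆ = 0 ∧
    b.coord 2 ⁅u, v⁆ = -structForm A B C D E (coordPair b u) (coordPair b v)

/-- An alternating real-bilinear form on ℂ² has six complex coefficients. The combination I f₄ + I
f₃ + f₂ at the sixth place is the vanishing of the ᾱ¹∧ᾱ² component; the remaining five determine A,
..., E. -/
theorem re_im_form_eq_neg_structForm (u v : ℂ × ℂ) (f₁ f₂ f₃ f₄ f₅ : ℂ) :
    (u.1.re * v.1.im - u.1.im * v.1.re : ℝ) * f₁ + (u.1.re * v.2.re - u.2.re * v.1.re : ℝ) * f₂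
      + (u.1.re * v.2.im - u.2.im * v.1.re : ℝ) * f₃
      + (u.1.im * v.2.re - u.2.re * v.1.im : ℝ) * f₄
      + (u.1.im * v.2.im - u.2.im * v.1.im : ℝ) * (I * f₄ + I * f₃ + f₂)
      + (u.2.re * v.2.im - u.2.im * v.2.re : ℝ) * f₅ =
    -structForm (-(f₂ + I * f₄) / 2) (I * f₅ / 2) (-I * f₁ / 2) (-(f₂ + I * f₃) / 2)
      (I * (f₃ + f₄) / 2) u v := by
  obtain ⟨⟨a, b⟩, c, d⟩ := u
  obtain ⟨⟨a', b'⟩, c', d'⟩ := v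
  have hI : I ^ 2 = -1 := Complex.I_sq
  have hI3 : I ^ 3 = -I := Complex.I_pow_three
  have hmk : ∀ x y : ℝ, (⟨x, y⟩ : ℂ) = x + y * I := fun x y => Complex.mk_eq_add_mul_I x y
  have hconj : ∀ x y : ℝ, conj (⟨x, y⟩ : ℂ) = x - y * I := fun x y => by
    apply Complex.ext <;> simp
  simp only [structForm, hconj]
  simp only [hmk]
  push_cast
  ring_nf
  simp only [hI, hI3]
  ring

variable [IsScalarTower ℝ ℂ L]

/-- Complete p to a basis with p last. Only the last coordinate of a bracket can be nonzero, and it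
depends only on the first two coordinates of the arguments because ℂp is central. -/
theorem exists_structureEq_of_central_complex_line (h3 : Module.finrank ℂ L = 3)
    (hN : IsIntegrableLie L) {p : L} (hp0 : p ≠ 0) (hp : ∀ v : L, ⁅p, v⁆ = 0)
    (hIp : ∀ v : L, ⁅I • p, v⁆ = 0) (hL : ∀ u v : L, ⁅u, v⁆ ∈ Submodule.span ℂ {p}) :
    ∃ (b : Module.Basis (Fin 3) ℂ L) (A B C D E : ℂ), StructureEq b A B C D E := by
  have hfd : FiniteDimensional ℂ L := Module.finite_of_finrank_pos (by omega)
  have hli : LinearIndependent ℂ ![p] :=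
    linearIndependent_finCons.2 ⟨linearIndependent_empty_type, by simpa using hp0⟩
  obtain ⟨x, hx⟩ := exists_linearIndependent_cons_of_lt_finrank hli (by omega)
  obtain ⟨y, hy⟩ := exists_linearIndependent_cons_of_lt_finrank hx (by omega)
  let b := basisOfLinearIndependentOfCardEqFinrank hy (by simp [h3])
  have hb : ∀ i, b i = (Fin.cons y (Fin.cons x ![p]) : Fin 3 → L) i := fun i => by simp [b]
  have hb0 : b 0 = y := hb 0
  have hb1 : b 1 = x := hb 1
  have hb2 : b 2 = p := hb 2
  have hcoord : ∀ (i : Fin 3) (u v : L), i ≠ 2 → b.coord i ⁅u, v⁆ = 0 := by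
    intro i u v hi
    obtain ⟨c, hc⟩ := Submodule.mem_span_singleton.1 (hL u v)
    rw [← hc, ← hb2, map_smul, Module.Basis.coord_apply, b.repr_self, Finsupp.single_apply,
      if_neg (Ne.symm hi), smul_zero]
  let F : L → L → ℂ := fun u v => b.coord 2 ⁅u, v⁆
  have hdec : ∀ u : L, u = (b.coord 0 u).re • y + (b.coord 0 u).im • I • y +
      ((b.coord 1 u).re • x + (b.coord 1 u).im • I • x) +
      ((b.coord 2 u).re • p + (b.coord 2 u).im • I • p) := by
    intro u
    rw [← smul_eq_re_smul_add_im_smul, ← smul_eq_re_smul_add_im_smul,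
      ← smul_eq_re_smul_add_im_smul]
    conv_lhs => rw [← b.sum_repr u, Fin.sum_univ_three, hb0, hb1, hb2]
    rfl
  have hp' : ∀ v : L, ⁅v, p⁆ = 0 := fun v => by rw [← lie_skew, hp, neg_zero]
  have hIp' : ∀ v : L, ⁅v, I • p⁆ = 0 := fun v => by rw [← lie_skew, hIp, neg_zero]
  have hskew : ∀ u v : L, b.coord 2 ⁅u, v⁆ = -b.coord 2 ⁅v, u⁆ := fun u v => by
    rw [← lie_skew, map_neg]
  -- Integrability determines the sixth coefficient from the other five.
  have hint : F (I • y) (I • x) = I * F (I • y) x + I * F y (I • x) + F y x := by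
    simp only [F]
    rw [hN.lie_I_smul_I_smul, map_add, map_add, map_smul, map_smul, smul_eq_mul, smul_eq_mul]
  refine ⟨b, -(F y x + I * F (I • y) x) / 2, I * F x (I • x) / 2, -I * F y (I • y) / 2,
    -(F y x + I * F y (I • x)) / 2, I * (F y (I • x) + F (I • y) x) / 2, fun u v =>
    ⟨hcoord 0 u v (by decide), hcoord 1 u v (by decide), ?_⟩⟩
  have hF : b.coord 2 ⁅u, v⁆ =
      ((b.coord 0 u).re * (b.coord 0 v).im - (b.coord 0 u).im * (b.coord 0 v).re : ℝ) * F y (I • y)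
      + ((b.coord 0 u).re * (b.coord 1 v).re - (b.coord 1 u).re * (b.coord 0 v).re : ℝ) * F y x
      + ((b.coord 0 u).re * (b.coord 1 v).im - (b.coord 1 u).im * (b.coord 0 v).re : ℝ) *
        F y (I • x)
      + ((b.coord 0 u).im * (b.coord 1 v).re - (b.coord 1 u).re * (b.coord 0 v).im : ℝ) *
        F (I • y) x
      + ((b.coord 0 u).im * (b.coord 1 v).im - (b.coord 1 u).im * (b.coord 0 v).im : ℝ) *
        F (I • y) (I • x)
      + ((b.coord 1 u).re * (b.coord 1 v).im - (b.coord 1 u).im * (b.coord 1 v).re : ℝ) *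
        F x (I • x) := by
    conv_lhs => rw [hdec u, hdec v]
    simp only [add_lie, lie_add, smul_lie, lie_smul, hp, hp', hIp, hIp', lie_self, smul_zero,
      add_zero, zero_add, map_add, LinearMap.map_smul_of_tower, Complex.real_smul,
      hskew x y, hskew (I • x) y, hskew x (I • y), hskew (I • x) (I • y), hskew (I • y) y,
      hskew (I • x) x, F]
    push_cast
    ring
  rw [hF, hint]
  exact re_im_form_eq_neg_structForm (coordPair b u) (coordPair b v) _ _ _ _ _

end StructureEquations

/-! ### The SKT condition in terms of the structure constants -/

section StrongTorsion

set_option linter.unusedSectionVars false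

open Complex (I)

variable {L : Type*} [LieRing L] [LieAlgebra ℝ L] [Module ℂ L] [IsScalarTower ℝ ℂ L]

theorem coordPair_I_smul (b : Module.Basis (Fin 3) ℂ L) (u : L) :
    coordPair b (I • u) = (I * (coordPair b u).1, I * (coordPair b u).2) := by
  simp [coordPair]

theorem StructureEq.lie_eq {b : Module.Basis (Fin 3) ℂ L} {A B C D E : ℂ}
    (h : StructureEq b A B C D E) (u v : L) :
    ⁅u, v⁆ = (-structForm A B C D E (coordPair b u) (coordPair b v)) • b 2 := by
  obtain ⟨h0, h1, h2⟩ := h u v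
  conv_lhs => rw [← b.sum_repr ⁅u, v⁆, Fin.sum_univ_three]
  rw [← b.coord_apply, ← b.coord_apply, ← b.coord_apply, h0, h1, h2, zero_smul, zero_smul,
    zero_add, zero_add]

theorem StructureEq.smul_lie_eq_zero {b : Module.Basis (Fin 3) ℂ L} {A B C D E : ℂ}
    (h : StructureEq b A B C D E) (c : ℂ) (v : L) : ⁅c • b 2, v⁆ = 0 := by
  have h0 : coordPair b (c • b 2) = (0, 0) := by
    simp [coordPair]
  rw [h.lie_eq, h0]
  simp [structForm]

theorem IsHermitianForm.apply_smul_smul {g : L →ₗ[ℝ] L →ₗ[ℝ] ℝ} (hg : IsHermitianForm g) (p : L)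
    (x y : ℂ) : g (x • p) (y • p) = g p p * (x * conj y).re := by
  have h : g p (I • p) = 0 := by rw [hg.symm]; exact hg.I_smul_self p
  rw [smul_eq_re_smul_add_im_smul x, smul_eq_re_smul_add_im_smul y]
  simp only [map_add, map_smul, LinearMap.add_apply, LinearMap.smul_apply, hg.herm, h,
    hg.I_smul_self, smul_eq_mul, Complex.mul_re, Complex.conj_re, Complex.conj_im]
  ring

/-- The value of `α¹ ∧ ᾱ¹ ∧ α² ∧ ᾱ²`. -/
def volForm (a b c d : ℂ × ℂ) : ℂ :=
  let s := fun u v : ℂ × ℂ => u.1 * conj v.1 - v.1 * conj u.1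
  let t := fun u v : ℂ × ℂ => u.2 * conj v.2 - v.2 * conj u.2
  s a b * t c d - s a c * t b d + s a d * t b c + s b c * t a d - s b d * t a c + s c d * t a b

/-- The left side is the wedge of JF with the conjugate of F. On ℂ² forms of type (3,1) and (1,3)
vanish, so only a multiple of α¹ᾱ¹α²ᾱ² remains. -/
theorem structForm_wedge (A B C D E : ℂ) (a b c d : ℂ × ℂ) :
    let F := structForm A B C D E
    let J := fun u : ℂ × ℂ => (I * u.1, I * u.2)
    F (J c) (J d) * conj (F a b) - F (J b) (J d) * conj (F a c) + F (J b) (J c) * conj (F a d)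
      + F (J a) (J d) * conj (F b c) - F (J a) (J c) * conj (F b d) + F (J a) (J b) * conj (F c d)
      = (A * conj A + D * conj D + E * conj E + (conj B * C + B * conj C)) * volForm a b c d := by
  intro F J
  -- J fixes (1,1)-forms and acts by -1 on the (2,0)-form α¹∧α².
  have hJ : ∀ u v : ℂ × ℂ, F (J u) (J v) = structForm A B C D (-E) u v := by
    intro u v
    simp only [F, J, structForm, map_mul, Complex.conj_I]
    ring_nf
    simp only [Complex.I_sq]
    ring
  simp only [hJ]
  simp only [F, structForm, volForm, map_add, map_mul, map_sub, Complex.conj_conj]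
  ring

/-- Brackets and their I-multiples are central, so the torsion of [u, v], w, z is -g([Iw, Iz], [u,
v]). Both brackets are multiples of `b 2`, hence the metric contributes only g(b₂, b₂). -/
theorem StructureEq.dTorsion_eq {b : Module.Basis (Fin 3) ℂ L} {A B C D E : ℂ}
    (h : StructureEq b A B C D E) {g : L →ₗ[ℝ] L →ₗ[ℝ] ℝ} (hg : IsHermitianForm g) (u v w z : L) :
    dTorsion g u v w z = g (b 2) (b 2) *
      (((‖A‖ ^ 2 + ‖D‖ ^ 2 + ‖E‖ ^ 2 + 2 * (conj B * C).re : ℝ) : ℂ) *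
        volForm (coordPair b u) (coordPair b v) (coordPair b w) (coordPair b z)).re := by
  have hT : ∀ u v w z : L, torsion g ⁅u, v⁆ w z = -g (b 2) (b 2) *
      (structForm A B C D E (coordPair b (I • w)) (coordPair b (I • z)) *
        conj (structForm A B C D E (coordPair b u) (coordPair b v))).re := by
    intro u v w z
    have h1 : ∀ w : L, ⁅I • ⁅u, v⁆, w⁆ = 0 := fun w => by
      rw [h.lie_eq u v, smul_smul, h.smul_lie_eq_zero]
    rw [torsion, h1, h1, h.lie_eq u v, h.lie_eq (I • w), hg.apply_smul_smul]
    simp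
  have hK : (((‖A‖ ^ 2 + ‖D‖ ^ 2 + ‖E‖ ^ 2 + 2 * (conj B * C).re : ℝ) : ℂ)) =
      A * conj A + D * conj D + E * conj E + (conj B * C + B * conj C) := by
    have h1 : conj B * C + B * conj C = (2 * (conj B * C).re : ℝ) := by
      apply Complex.ext <;> simp <;> ring
    rw [h1, Complex.mul_conj', Complex.mul_conj', Complex.mul_conj']
    push_cast
    ring
  rw [hK, ← structForm_wedge]
  simp only [dTorsion, hT, coordPair_I_smul, Complex.add_re, Complex.sub_re]
  ring

/-- Whether `∂∂̄Ω = 0` depends on the structure equations only. -/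
theorem StructureEq.dTorsion_eq_zero_iff {b : Module.Basis (Fin 3) ℂ L} {A B C D E : ℂ}
    (h : StructureEq b A B C D E) {g : L →ₗ[ℝ] L →ₗ[ℝ] ℝ} (hg : IsHermitianForm g) :
    (∀ u v w z, dTorsion g u v w z = 0) ↔
      ‖A‖ ^ 2 + ‖D‖ ^ 2 + ‖E‖ ^ 2 + 2 * (conj B * C).re = 0 := by
  constructor
  · intro h0
    have h1 := h0 (b 0) (I • b 0) (b 1) (I • b 1)
    -- Each factor αⁱ∧ᾱⁱ takes the value -2i on (bᵢ, I bᵢ), and (-2i)² = -4.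
    have hv : volForm (coordPair b (b 0)) (coordPair b (I • b 0)) (coordPair b (b 1))
        (coordPair b (I • b 1)) = ((-4 : ℝ) : ℂ) := by
      simp only [coordPair_I_smul]
      simp [coordPair, volForm]
      ring_nf
      simp
    rw [h.dTorsion_eq hg, hv, ← Complex.ofReal_mul, Complex.ofReal_re] at h1
    have h2 := hg.pos (b 2) (b.ne_zero 2)
    have h3 := (mul_eq_zero.1 h1).resolve_left h2.ne'
    linarith
  · intro h0 u v w z
    rw [h.dTorsion_eq hg, h0]
    simp

/-- The values of `dΩ` on left-invariant vector fields. -/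
def dFund (g : L →ₗ[ℝ] L →ₗ[ℝ] ℝ) (a b c : L) : ℝ :=
  -g (I • ⁅a, b⁆) c + g (I • ⁅a, c⁆) b - g (I • ⁅b, c⁆) a

theorem StructureEq.lie_eq_zero_iff {b : Module.Basis (Fin 3) ℂ L} {A B C D E : ℂ}
    (h : StructureEq b A B C D E) :
    (∀ u v : L, ⁅u, v⁆ = 0) ↔ A = 0 ∧ B = 0 ∧ C = 0 ∧ D = 0 ∧ E = 0 := by
  constructor
  · intro h0
    have hF : ∀ u v : L, structForm A B C D E (coordPair b u) (coordPair b v) = 0 := fun u v => by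
      have := (h u v).2.2
      rw [h0, map_zero] at this
      exact neg_eq_zero.1 this.symm
    have h1 := hF (b 0) (I • b 0)
    have h2 := hF (b 1) (I • b 1)
    have h3 := hF (b 0) (b 1)
    have h4 := hF (I • b 0) (b 1)
    have h5 := hF (b 0) (I • b 1)
    simp only [coordPair_I_smul] at h1 h2 h4 h5
    simp [coordPair, structForm] at h1 h2 h3 h4 h5
    have hC : C = 0 := h1.resolve_right fun h => by
      have := congrArg Complex.im h
      norm_num at this
    have h4' : -A + D + E = 0 := by
      refine (mul_eq_zero.1 (?_ : (-A + D + E) * I = 0)).resolve_right Complex.I_ne_zero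
      linear_combination h4
    have h5' : A - D + E = 0 := by
      refine (mul_eq_zero.1 (?_ : (A - D + E) * I = 0)).resolve_right Complex.I_ne_zero
      linear_combination h5
    exact ⟨by linear_combination (h3 - h4') / 2, h2, hC, by linear_combination (h3 - h5') / 2,
      by linear_combination (h4' + h5') / 2⟩
  · rintro ⟨rfl, rfl, rfl, rfl, rfl⟩ u v
    rw [h.lie_eq]
    simp [structForm]

/-- Since I[u, v] is central, dΩ(u, v, I[u, v]) = -|[u, v]|²; thus a closed Ω forces L to be
abelian. -/
theorem StructureEq.dFund_eq_zero_iff {b : Module.Basis (Fin 3) ℂ L} {A B C D E : ℂ}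
    (h : StructureEq b A B C D E) {g : L →ₗ[ℝ] L →ₗ[ℝ] ℝ} (hg : IsHermitianForm g) :
    (∀ u v w, dFund g u v w = 0) ↔ A = 0 ∧ B = 0 ∧ C = 0 ∧ D = 0 ∧ E = 0 := by
  rw [← h.lie_eq_zero_iff]
  constructor
  · intro h0 u v
    have h1 := h0 u v (I • ⁅u, v⁆)
    have h2 : ∀ w : L, ⁅w, I • ⁅u, v⁆⁆ = 0 := fun w => by
      rw [← lie_skew, h.lie_eq u v, smul_smul, h.smul_lie_eq_zero, neg_zero]
    rw [dFund, h2, h2, hg.herm] at h1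
    refine hg.eq_zero (le_of_eq ?_)
    simpa using h1
  · intro h0 u v w
    simp [dFund, h0]

/-- The Hermitian inner product for which a complex basis is unitary. -/
def stdForm (b : Module.Basis (Fin 3) ℂ L) : L →ₗ[ℝ] L →ₗ[ℝ] ℝ :=
  LinearMap.mk₂ ℝ (fun u v => ∑ i, (b.coord i u * conj (b.coord i v)).re)
    (fun u v w => by simp only [map_add, add_mul, Complex.add_re, Finset.sum_add_distrib])
    (fun c u v => by
      simp only [LinearMap.map_smul_of_tower, smul_mul_assoc, Complex.smul_re, smul_eq_mul,
        Finset.mul_sum])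
    (fun u v w => by simp only [map_add, mul_add, Complex.add_re, Finset.sum_add_distrib])
    (fun c u v => by
      simp only [LinearMap.map_smul_of_tower, Complex.real_smul, map_mul, Complex.conj_ofReal,
        mul_left_comm, Complex.re_ofReal_mul, Finset.mul_sum, smul_eq_mul])

theorem stdForm_apply (b : Module.Basis (Fin 3) ℂ L) (u v : L) :
    stdForm b u v = ∑ i, (b.coord i u * conj (b.coord i v)).re := rfl

theorem isHermitianForm_stdForm (b : Module.Basis (Fin 3) ℂ L) : IsHermitianForm (stdForm b) where
  symm u v := by
    rw [stdForm_apply, stdForm_apply]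
    refine Finset.sum_congr rfl fun i _ => ?_
    simp only [Complex.mul_re, Complex.conj_re, Complex.conj_im]; ring
  pos u hu := by
    rw [stdForm_apply]
    refine Finset.sum_pos' (fun i _ => ?_) ?_
    · rw [Complex.mul_conj, Complex.ofReal_re]; exact Complex.normSq_nonneg _
    · by_contra! h
      refine hu (b.ext_elem fun i => ?_)
      have h1 := h i (Finset.mem_univ i)
      rw [Complex.mul_conj, Complex.ofReal_re] at h1
      rw [map_zero, Finsupp.zero_apply, ← b.coord_apply]
      exact Complex.normSq_eq_zero.1 (le_antisymm h1 (Complex.normSq_nonneg _))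
  herm u v := by
    rw [stdForm_apply, stdForm_apply]
    refine Finset.sum_congr rfl fun i _ => ?_
    rw [map_smul, map_smul, smul_eq_mul, smul_eq_mul, map_mul, Complex.conj_I]
    congr 1
    linear_combination (-(b.coord i u) * conj (b.coord i v)) * Complex.I_sq

/-- A complex basis with given coordinates. -/
theorem exists_basis_coord_eq [FiniteDimensional ℂ L]
    (β : Module.Basis (Fin 3) ℂ (Module.Dual ℂ L)) :
    ∃ b : Module.Basis (Fin 3) ℂ L, ∀ i, b.coord i = β i := by
  refine ⟨β.dualBasis.map (Module.evalEquiv ℂ L).symm, fun i => LinearMap.ext fun v => ?_⟩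
  rw [Module.Basis.coord_apply, Module.Basis.map_repr, LinearEquiv.trans_apply,
    LinearEquiv.symm_symm, Module.Basis.dualBasis_repr]
  rfl

end StrongTorsion

/-! ### Explicit differentials of frame forms in degrees 1, 2 and 3 -/

section FrameForms

variable {E : Type*} [NormedAddCommGroup E] [NormedSpace ℝ E]
  {M : Type*} [TopologicalSpace M] [ChartedSpace E M]
  {L : Type*} [LieRing L] [LieAlgebra ℝ L] {X : ∀ m : M, L ≃ₗ[ℝ] TangentSpace 𝓘(ℝ, E) m}

theorem form_ext_frame (X : ∀ m : M, L ≃ₗ[ℝ] TangentSpace 𝓘(ℝ, E) m) {k : ℕ} {η ζ : Form E M k}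
    (h : ∀ m (v : Fin k → L), η m (fun i => X m (v i)) = ζ m (fun i => X m (v i))) : η = ζ := by
  funext m
  refine ContinuousAlternatingMap.ext fun v => ?_
  have := h m fun i => (X m).symm (v i)
  simpa using this

variable [FiniteDimensional ℝ E] [IsManifold 𝓘(ℝ, E) ∞ M]

theorem extDer_one_apply_frame (hX : IsLieFrame X) {η : Form E M 1} {a : L → ℂ}
    (h : ∀ m (v : Fin 1 → L), η m (fun i => X m (v i)) = a (v 0)) (m : M) (v : Fin 2 → L) :
    extDer η m (fun i => X m (v i)) = -a ⁅v 0, v 1⁆ := by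
  rw [extDer_apply_frame hX (a := fun v => a (v 0)) h]
  simp

theorem extDer_two_apply_frame (hX : IsLieFrame X) {η : Form E M 2} {a : L → L → ℂ}
    (h : ∀ m (v : Fin 2 → L), η m (fun i => X m (v i)) = a (v 0) (v 1)) (m : M) (v : Fin 3 → L) :
    extDer η m (fun i => X m (v i)) =
      -a ⁅v 0, v 1⁆ (v 2) + a ⁅v 0, v 2⁆ (v 1) - a ⁅v 1, v 2⁆ (v 0) := by
  rw [extDer_apply_frame hX (a := fun v => a (v 0) (v 1)) h]
  have h0 : Finset.Ici (0 : Fin 2) = {0, 1} := by decide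
  have h1 : Finset.Ici (1 : Fin 2) = {1} := by decide
  simp [Fin.sum_univ_succ, Fin.removeNth, h0, h1, Fin.succAbove]
  ring

theorem extDer_three_apply_frame (hX : IsLieFrame X) {η : Form E M 3} {a : L → L → L → ℂ}
    (h : ∀ m (v : Fin 3 → L), η m (fun i => X m (v i)) = a (v 0) (v 1) (v 2)) (m : M)
    (v : Fin 4 → L) :
    extDer η m (fun i => X m (v i)) =
      -a ⁅v 0, v 1⁆ (v 2) (v 3) + a ⁅v 0, v 2⁆ (v 1) (v 3) - a ⁅v 0, v 3⁆ (v 1) (v 2)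
        - a ⁅v 1, v 2⁆ (v 0) (v 3) + a ⁅v 1, v 3⁆ (v 0) (v 2) - a ⁅v 2, v 3⁆ (v 0) (v 1) := by
  rw [extDer_apply_frame hX (a := fun v => a (v 0) (v 1) (v 2)) h]
  have h0 : Finset.Ici (0 : Fin 3) = {0, 1, 2} := by decide
  have h1 : Finset.Ici (1 : Fin 3) = {1, 2} := by decide
  have h2 : Finset.Ici (2 : Fin 3) = {2} := by decide
  simp [Fin.sum_univ_succ, Fin.removeNth, h0, h1, h2, Fin.succAbove]
  ring

end FrameForms

/-! ### Translation between forms on the manifold and the Lie algebra -/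

section FrameGeometry

open Complex (I)

variable {E : Type*} [NormedAddCommGroup E] [NormedSpace ℝ E]
  {M : Type*} [TopologicalSpace M] [ChartedSpace E M] [IsManifold 𝓘(ℝ, E) ∞ M]
  {L : Type*} [LieRing L] [LieAlgebra ℝ L] {X : ∀ m : M, L ≃ₗ[ℝ] TangentSpace 𝓘(ℝ, E) m}

theorem extDer_one_eq_zero_iff [FiniteDimensional ℝ E] [Nonempty M] (hX : IsLieFrame X) {η : Form E M 1} {a : L → ℂ}
    (h : ∀ m (v : Fin 1 → L), η m (fun i => X m (v i)) = a (v 0)) :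
    extDer η = 0 ↔ ∀ u v : L, a ⁅u, v⁆ = 0 := by
  constructor
  · intro h0 u v
    have h1 := extDer_one_apply_frame hX h (Classical.arbitrary M) ![u, v]
    rw [h0] at h1
    exact neg_eq_zero.1 h1.symm
  · intro h0
    refine form_ext_frame X fun m v => ?_
    rw [extDer_one_apply_frame hX h, h0, neg_zero]
    rfl

variable [Module ℂ L] {J : ∀ m : M, TangentSpace 𝓘(ℝ, E) m →L[ℝ] TangentSpace 𝓘(ℝ, E) m}

theorem IsIntegrable.isIntegrableLie [Nonempty M] (hX : IsLieFrame X)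
    (hJ : ∀ m v, J m (X m v) = X m (I • v)) (h : IsIntegrable J) : IsIntegrableLie L := by
  intro u v
  let m := Classical.arbitrary M
  have h1 := h (fun p => X p u) (fun p => X p v) (hX.smooth u) (hX.smooth v) m
  simp only [hJ, hX.bracket] at h1
  rw [← map_sub, ← map_sub, ← map_sub] at h1
  exact (X m).map_eq_zero_iff.1 h1

variable [FiniteDimensional ℝ E]

/-- The rule dα(u, v) = -α([u, v]) accounts for the minus sign in `StructureEq`. -/
theorem extDer_basis_iff [Nonempty M] (hX : IsLieFrame X) {α : Fin 3 → Form E M 1}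
    {b : Module.Basis (Fin 3) ℂ L}
    (h : ∀ i m (v : Fin 1 → L), α i m (fun j => X m (v j)) = b.coord i (v 0)) (A B C D F : ℂ) :
    StructureEq b A B C D F ↔ extDer (α 0) = 0 ∧ extDer (α 1) = 0 ∧
      extDer (α 2) = A • wedge (conjForm (α 0)) (α 1) + B • wedge (conjForm (α 1)) (α 1) +
        C • wedge (α 0) (conjForm (α 0)) + D • wedge (α 0) (conjForm (α 1)) +
        F • wedge (α 0) (α 1) := by
  have hR : ∀ m (v : Fin 2 → L),
      (A • wedge (conjForm (α 0)) (α 1) + B • wedge (conjForm (α 1)) (α 1) +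
        C • wedge (α 0) (conjForm (α 0)) + D • wedge (α 0) (conjForm (α 1)) +
        F • wedge (α 0) (α 1)) m (fun i => X m (v i)) =
      structForm A B C D F (coordPair b (v 0)) (coordPair b (v 1)) := by
    intro m v
    have h' : ∀ i u, α i m (fun _ => X m u) = b.coord i u := fun i u => h i m fun _ => u
    change A * (conj (α 0 m fun _ => X m (v 0)) * α 1 m (fun _ => X m (v 1)) -
        conj (α 0 m fun _ => X m (v 1)) * α 1 m (fun _ => X m (v 0))) +
      B * (conj (α 1 m fun _ => X m (v 0)) * α 1 m (fun _ => X m (v 1)) -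
        conj (α 1 m fun _ => X m (v 1)) * α 1 m (fun _ => X m (v 0))) +
      C * (α 0 m (fun _ => X m (v 0)) * conj (α 0 m fun _ => X m (v 1)) -
        α 0 m (fun _ => X m (v 1)) * conj (α 0 m fun _ => X m (v 0))) +
      D * (α 0 m (fun _ => X m (v 0)) * conj (α 1 m fun _ => X m (v 1)) -
        α 0 m (fun _ => X m (v 1)) * conj (α 1 m fun _ => X m (v 0))) +
      F * (α 0 m (fun _ => X m (v 0)) * α 1 m (fun _ => X m (v 1)) -
        α 0 m (fun _ => X m (v 1)) * α 1 m (fun _ => X m (v 0))) = _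
    simp only [h', structForm, coordPair]
  rw [extDer_one_eq_zero_iff hX (h 0), extDer_one_eq_zero_iff hX (h 1)]
  constructor
  · intro hS
    refine ⟨fun u v => (hS u v).1, fun u v => (hS u v).2.1, form_ext_frame X fun m v => ?_⟩
    rw [hR, extDer_one_apply_frame hX (h 2), (hS _ _).2.2, neg_neg]
  · rintro ⟨h0, h1, h2⟩ u v
    refine ⟨h0 u v, h1 u v, ?_⟩
    have h3 := hR (Classical.arbitrary M) ![u, v]
    rw [← h2, extDer_one_apply_frame hX (h 2)] at h3
    exact neg_eq_iff_eq_neg.1 h3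

variable {g : L →ₗ[ℝ] L →ₗ[ℝ] ℝ} {Ω : Form E M 2}

theorem extDer_fundamental_apply_frame (hX : IsLieFrame X)
    (hΩ : ∀ m (v : Fin 2 → L), Ω m (fun i => X m (v i)) = (g (I • v 0) (v 1) : ℝ)) (m : M)
    (v : Fin 3 → L) :
    extDer Ω m (fun i => X m (v i)) = (dFund g (v 0) (v 1) (v 2) : ℝ) := by
  rw [extDer_two_apply_frame hX (a := fun u v => (g (I • u) v : ℝ)) hΩ]
  simp [dFund]

theorem extDer_fundamental_eq_zero_iff [Nonempty M] (hX : IsLieFrame X)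
    (hΩ : ∀ m (v : Fin 2 → L), Ω m (fun i => X m (v i)) = (g (I • v 0) (v 1) : ℝ)) :
    extDer Ω = 0 ↔ ∀ u v w, dFund g u v w = 0 := by
  constructor
  · intro h u v w
    have h1 := extDer_fundamental_apply_frame hX hΩ (Classical.arbitrary M) ![u, v, w]
    rw [h] at h1
    exact Complex.ofReal_eq_zero.1 h1.symm
  · intro h
    refine form_ext_frame X fun m v => ?_
    rw [extDer_fundamental_apply_frame hX hΩ, h]
    rfl

theorem ddbar_fundamental_eq_zero_iff [Nonempty M] (hX : IsLieFrame X)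
    (hJ : ∀ m v, J m (X m v) = X m (I • v)) (hg : IsHermitianForm g)
    (hΩ : ∀ m (v : Fin 2 → L), Ω m (fun i => X m (v i)) = (g (I • v 0) (v 1) : ℝ)) :
    ddbar J Ω = 0 ↔ ∀ u v w z, dTorsion g u v w z = 0 := by
  have h1 : ∀ m (v : Fin 3 → L), actJ J (extDer Ω) m (fun i => X m (v i)) =
      (torsion g (v 0) (v 1) (v 2) : ℝ) := by
    intro m v
    change extDer Ω m (fun i => J m (X m (v i))) = _
    simp only [hJ]
    rw [extDer_fundamental_apply_frame hX hΩ m fun i => I • v i]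
    -- With all arguments multiplied by I, orthogonality of I cancels the I in front of each
    -- bracket.
    simp only [dFund, torsion, hg.herm]
  have h2 : ∀ m (v : Fin 4 → L), ddbar J Ω m (fun i => X m (v i)) =
      I / 2 * (dTorsion g (v 0) (v 1) (v 2) (v 3) : ℝ) := by
    intro m v
    change I / 2 * extDer (actJ J (extDer Ω)) m (fun i => X m (v i)) = _
    rw [extDer_three_apply_frame hX (a := fun u v w => (torsion g u v w : ℝ)) h1]
    simp [dTorsion]
  constructor
  · intro h u v w z
    have h3 := h2 (Classical.arbitrary M) ![u, v, w, z]
    rw [h] at h3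
    exact Complex.ofReal_eq_zero.1 ((mul_eq_zero.1 h3.symm).resolve_left (by simp))
  · intro h
    refine form_ext_frame X fun m v => ?_
    rw [h2, h, Complex.ofReal_zero, mul_zero]
    rfl

end FrameGeometry

/-! ### Invariant metrics and (1,0)-forms as linear algebra on the Lie algebra -/

section InvariantStructures

set_option linter.unusedSectionVars false

open Complex (I)

variable {E : Type*} [NormedAddCommGroup E] [NormedSpace ℝ E] [CompleteSpace E]
  {G : Type*} [TopologicalSpace G] [ChartedSpace E G] [Group G] [LieGroup 𝓘(ℝ, E) ∞ G]
  {Γ : Subgroup G} [ChartedSpace E (OrbitSpace Γ)] [IsManifold 𝓘(ℝ, E) ∞ (OrbitSpace Γ)]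
  [Module ℂ (GroupLieAlgebra 𝓘(ℝ, E) G)] {S : InvariantComplexStructure E Γ}

/-- The complex structure of the Lie algebra of `G` induces the almost complex structure of
`Γ\G`. -/
def InvariantComplexStructure.IsInducedBySMul (S : InvariantComplexStructure E Γ) : Prop :=
  ∀ x (v : GroupLieAlgebra 𝓘(ℝ, E) G), S.J (proj Γ x) (invField Γ v x) = invField Γ (I • v) x

theorem InvariantComplexStructure.IsInducedBySMul.apply_invFrame (hS : S.IsInducedBySMul)
    (hπ : IsLocalDiffeomorph 𝓘(ℝ, E) 𝓘(ℝ, E) ∞ (proj Γ)) (m : OrbitSpace Γ)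
    (v : GroupLieAlgebra 𝓘(ℝ, E) G) : S.J m (invFrame hπ m v) = invFrame hπ m (I • v) := by
  obtain ⟨x, rfl⟩ := proj_surjective m
  rw [invFrame_proj, invFrame_proj, hS]

theorem InvariantComplexStructure.IsInducedBySMul.symm_apply (hS : S.IsInducedBySMul)
    (hπ : IsLocalDiffeomorph 𝓘(ℝ, E) 𝓘(ℝ, E) ∞ (proj Γ)) (m : OrbitSpace Γ)
    (u : TangentSpace 𝓘(ℝ, E) m) : (invFrame hπ m).symm (S.J m u) = I • (invFrame hπ m).symm u := by
  rw [LinearEquiv.symm_apply_eq, ← hS.apply_invFrame hπ, LinearEquiv.apply_symm_apply]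

namespace InvariantHermitianMetric

/-- The inner product on the Lie algebra of `G` which induces an invariant Hermitian metric. -/
def lieForm (h : InvariantHermitianMetric S)
    (hπ : IsLocalDiffeomorph 𝓘(ℝ, E) 𝓘(ℝ, E) ∞ (proj Γ)) :
    GroupLieAlgebra 𝓘(ℝ, E) G →ₗ[ℝ] GroupLieAlgebra 𝓘(ℝ, E) G →ₗ[ℝ] ℝ :=
  LinearMap.mk₂ ℝ
    (fun v w => h.g (proj Γ 1) (invFrame hπ (proj Γ 1) v) (invFrame hπ (proj Γ 1) w))
    (fun u v w => by rw [map_add, map_add, add_apply])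
    (fun c u v => by rw [map_smul, map_smul, smul_apply])
    (fun u v w => by rw [map_add, map_add])
    (fun c u v => by rw [map_smul, map_smul])

theorem g_invFrame (h : InvariantHermitianMetric S)
    (hπ : IsLocalDiffeomorph 𝓘(ℝ, E) 𝓘(ℝ, E) ∞ (proj Γ)) (m : OrbitSpace Γ)
    (v w : GroupLieAlgebra 𝓘(ℝ, E) G) :
    h.g m (invFrame hπ m v) (invFrame hπ m w) = h.lieForm hπ v w := by
  obtain ⟨g₀, hg⟩ := h.invariant
  obtain ⟨x, rfl⟩ := proj_surjective m
  change _ = h.g (proj Γ 1) (invFrame hπ (proj Γ 1) v) (invFrame hπ (proj Γ 1) w)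
  rw [invFrame_proj, invFrame_proj, invFrame_proj, invFrame_proj, hg, hg]

theorem isHermitianForm_lieForm (h : InvariantHermitianMetric S) (hS : S.IsInducedBySMul)
    (hπ : IsLocalDiffeomorph 𝓘(ℝ, E) 𝓘(ℝ, E) ∞ (proj Γ)) : IsHermitianForm (h.lieForm hπ) where
  symm u v := h.symm _ _ _
  pos u hu := h.pos _ _ ((invFrame hπ _).map_ne_zero_iff.2 hu)
  herm u v := by
    rw [← h.g_invFrame hπ (proj Γ 1), ← h.g_invFrame hπ (proj Γ 1), ← hS.apply_invFrame,
      ← hS.apply_invFrame, h.hermitian]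

theorem fundForm_apply_invFrame (h : InvariantHermitianMetric S) (hS : S.IsInducedBySMul)
    (hπ : IsLocalDiffeomorph 𝓘(ℝ, E) 𝓘(ℝ, E) ∞ (proj Γ)) (m : OrbitSpace Γ)
    (v : Fin 2 → GroupLieAlgebra 𝓘(ℝ, E) G) :
    h.fundForm m (fun i => invFrame hπ m (v i)) = (h.lieForm hπ (I • v 0) (v 1) : ℝ) := by
  change ((h.g m (S.J m (invFrame hπ m (v 0))) (invFrame hπ m (v 1)) : ℝ) : ℂ) = _
  rw [hS.apply_invFrame, h.g_invFrame]

end InvariantHermitianMetric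

theorem InvariantHermitianMetric.isSKT_iff [FiniteDimensional ℝ E] (h : InvariantHermitianMetric S)
    (hS : S.IsInducedBySMul) (hπ : IsLocalDiffeomorph 𝓘(ℝ, E) 𝓘(ℝ, E) ∞ (proj Γ)) :
    h.IsSKT ↔ (∀ u v w z, dTorsion (h.lieForm hπ) u v w z = 0) ∧
      ¬ ∀ u v w, dFund (h.lieForm hπ) u v w = 0 := by
  have : Nonempty (OrbitSpace Γ) := ⟨proj Γ 1⟩
  have hX := isLieFrame_invFrame hπ
  rw [IsSKT, ddbar_fundamental_eq_zero_iff hX (hS.apply_invFrame hπ)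
    (h.isHermitianForm_lieForm hS hπ) (h.fundForm_apply_invFrame hS hπ), Ne,
    extDer_fundamental_eq_zero_iff hX (h.fundForm_apply_invFrame hS hπ)]

variable [FiniteDimensional ℝ E]

/-- The inverse of the frame of left-invariant vector fields, on the model space. -/
def invCoframe (hπ : IsLocalDiffeomorph 𝓘(ℝ, E) 𝓘(ℝ, E) ∞ (proj Γ)) (m : OrbitSpace Γ) :
    E →ₗ[ℝ] GroupLieAlgebra 𝓘(ℝ, E) G :=
  let e : TangentSpace 𝓘(ℝ, E) m →ₗ[ℝ] GroupLieAlgebra 𝓘(ℝ, E) G := (invFrame hπ m).symm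
  e

/-- Transport g to every tangent space by the frame. -/
theorem exists_invariantHermitianMetric (hS : S.IsInducedBySMul)
    (hπ : IsLocalDiffeomorph 𝓘(ℝ, E) 𝓘(ℝ, E) ∞ (proj Γ))
    {g : GroupLieAlgebra 𝓘(ℝ, E) G →ₗ[ℝ] GroupLieAlgebra 𝓘(ℝ, E) G →ₗ[ℝ] ℝ}
    (hg : IsHermitianForm g) : Nonempty (InvariantHermitianMetric S) :=
  ⟨{  g := fun m =>
        (LinearMap.toContinuousBilinearMap (g.compl₁₂ (invCoframe hπ m) (invCoframe hπ m)) :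
          E →L[ℝ] E →L[ℝ] ℝ)
      symm := fun m u v => hg.symm _ _
      pos := fun m u hu => hg.pos _ ((invFrame hπ m).symm.map_ne_zero_iff.2 hu)
      hermitian := fun m u v => by
        change g ((invFrame hπ m).symm (S.J m u)) ((invFrame hπ m).symm (S.J m v)) =
          g ((invFrame hπ m).symm u) ((invFrame hπ m).symm v)
        rw [hS.symm_apply, hS.symm_apply, hg.herm]
      invariant := ⟨fun v w => g v w, fun x v w => by
        change g ((invFrame hπ (proj Γ x)).symm (invField Γ v x))
          ((invFrame hπ (proj Γ x)).symm (invField Γ w x)) = g v w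
        rw [← invFrame_proj hπ, ← invFrame_proj hπ, LinearEquiv.symm_apply_apply,
          LinearEquiv.symm_apply_apply]⟩ }⟩

variable [IsScalarTower ℝ ℂ (GroupLieAlgebra 𝓘(ℝ, E) G)]

theorem vec_single_eq_const {α : Type*} (u : α) : ![u] = fun _ => u :=
  funext fun i => by rw [Subsingleton.elim i 0]; rfl

theorem oneZeroForms_apply_invFrame (hπ : IsLocalDiffeomorph 𝓘(ℝ, E) 𝓘(ℝ, E) ∞ (proj Γ))
    (α : S.oneZeroForms) (m : OrbitSpace Γ) (v : GroupLieAlgebra 𝓘(ℝ, E) G) :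
    α.1 m (fun _ => invFrame hπ m v) = α.1 (proj Γ 1) (fun _ => invFrame hπ (proj Γ 1) v) := by
  obtain ⟨a, ha⟩ := α.2.2
  obtain ⟨x, rfl⟩ := proj_surjective m
  rw [invFrame_proj, invFrame_proj, ← vec_single_eq_const, ← vec_single_eq_const, ha, ha]

/-- Invariant forms of type `(1, 0)` are the complex-linear forms on the Lie algebra of `G`. -/
def oneZeroFormsEquiv (hS : S.IsInducedBySMul)
    (hπ : IsLocalDiffeomorph 𝓘(ℝ, E) 𝓘(ℝ, E) ∞ (proj Γ)) :
    S.oneZeroForms ≃ₗ[ℂ] Module.Dual ℂ (GroupLieAlgebra 𝓘(ℝ, E) G) where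
  toFun α :=
    { toFun := fun v => α.1 (proj Γ 1) fun _ => invFrame hπ (proj Γ 1) v
      map_add' := fun u v => by rw [map_add, form_one_add]
      map_smul' := fun c v => by
        have hI : α.1 (proj Γ 1) (fun _ => invFrame hπ (proj Γ 1) (I • v)) =
            I * α.1 (proj Γ 1) (fun _ => invFrame hπ (proj Γ 1) v) := by
          rw [← hS.apply_invFrame, ← vec_single_eq_const, ← vec_single_eq_const, α.2.1]
        rw [smul_eq_re_smul_add_im_smul, map_add, form_one_add, map_smul, map_smul, form_one_smul,
          form_one_smul, hI, RingHom.id_apply, smul_eq_mul, Complex.real_smul, Complex.real_smul]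
        conv_rhs => rw [← Complex.re_add_im c]
        ring }
  map_add' α β := rfl
  map_smul' c α := rfl
  invFun a := ⟨fun m => ContinuousAlternatingMap.ofSubsingleton ℝ E ℂ (0 : Fin 1)
      (LinearMap.toContinuousLinearMap
        ((a.restrictScalars ℝ) ∘ₗ invCoframe hπ m)),
    fun m u => by
      change a ((invFrame hπ m).symm (S.J m u)) = I * a ((invFrame hπ m).symm u)
      rw [hS.symm_apply, map_smul, smul_eq_mul],
    a, fun x v => by
      change a ((invFrame hπ (proj Γ x)).symm (invField Γ v x)) = a v
      rw [← invFrame_proj hπ, LinearEquiv.symm_apply_apply]⟩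
  left_inv α := Subtype.ext <| form_ext_frame (invFrame hπ) fun m v => by
    change α.1 (proj Γ 1) (fun _ => invFrame hπ (proj Γ 1)
      ((invFrame hπ m).symm (invFrame hπ m (v 0)))) = _
    rw [LinearEquiv.symm_apply_apply, ← oneZeroForms_apply_invFrame hπ α m]
    exact congrArg (α.1 m) (funext fun i => by rw [Subsingleton.elim i 0])
  right_inv a := LinearMap.ext fun v => by
    change a ((invFrame hπ (proj Γ 1)).symm (invFrame hπ (proj Γ 1) v)) = a v
    rw [LinearEquiv.symm_apply_apply]

theorem oneZeroFormsEquiv_apply (hS : S.IsInducedBySMul)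
    (hπ : IsLocalDiffeomorph 𝓘(ℝ, E) 𝓘(ℝ, E) ∞ (proj Γ)) (α : S.oneZeroForms) (m : OrbitSpace Γ)
    (v : Fin 1 → GroupLieAlgebra 𝓘(ℝ, E) G) :
    α.1 m (fun i => invFrame hπ m (v i)) = oneZeroFormsEquiv hS hπ α (v 0) :=
  (congrArg (α.1 m) (funext fun i => by rw [Subsingleton.elim i 0])).trans
    (oneZeroForms_apply_invFrame hπ α m (v 0))

end InvariantStructures

/-! ### The complex Lie algebra of (Γ\G, J) and the SKT criterion -/

section Classification

open Complex (I)

theorem exists_complex_module {V : Type*} [AddCommGroup V] [Module ℝ V] (J : V →ₗ[ℝ] V)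
    (hJ : ∀ v, J (J v) = -v) :
    ∃ _ : Module ℂ V, IsScalarTower ℝ ℂ V ∧ ∀ v, I • v = J v := by
  have hJ2 : J * J = -1 := LinearMap.ext hJ
  let φ : ℂ →ₐ[ℝ] Module.End ℝ V := Complex.lift ⟨J, hJ2⟩
  let m : Module ℂ V := Module.compHom V φ.toRingHom
  have hs : ∀ (c : ℂ) (v : V), c • v = φ c v := fun _ _ => rfl
  refine ⟨m, ⟨fun r c v => ?_⟩, fun v => ?_⟩
  · rw [hs, hs, map_smul]; rfl
  · rw [hs]
    exact congrArg (fun f : Module.End ℝ V => f v) (Complex.liftAux_apply_I J hJ2)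

variable {E : Type*} [NormedAddCommGroup E] [NormedSpace ℝ E]
  {G : Type*} [TopologicalSpace G] [ChartedSpace E G] [Group G] [LieGroup 𝓘(ℝ, E) ∞ G]
  {Γ : Subgroup G} [ChartedSpace E (OrbitSpace Γ)] [IsManifold 𝓘(ℝ, E) ∞ (OrbitSpace Γ)]
  [CompleteSpace E] {S : InvariantComplexStructure E Γ}

theorem InvariantComplexStructure.exists_isInducedBySMul (S : InvariantComplexStructure E Γ)
    (hπ : IsLocalDiffeomorph 𝓘(ℝ, E) 𝓘(ℝ, E) ∞ (proj Γ)) :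
    ∃ (_ : Module ℂ (GroupLieAlgebra 𝓘(ℝ, E) G)),
      IsScalarTower ℝ ℂ (GroupLieAlgebra 𝓘(ℝ, E) G) ∧ S.IsInducedBySMul := by
  obtain ⟨J, hJ⟩ := S.invariant
  -- The inducing endomorphism is not assumed to square to -1; it inherits this from the tangent
  -- space at one point.
  have hJ2 : ∀ v, J (J v) = -v := fun v => by
    apply (invFrame hπ (proj Γ 1)).injective
    rw [map_neg, invFrame_proj, invFrame_proj, ← hJ, ← hJ, S.sq_eq_neg]
  obtain ⟨m, hm, hI⟩ := exists_complex_module J hJ2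
  exact ⟨m, hm, fun x v => by rw [hI, hJ]⟩

variable [FiniteDimensional ℝ E] [Module ℂ (GroupLieAlgebra 𝓘(ℝ, E) G)]
  [IsScalarTower ℝ ℂ (GroupLieAlgebra 𝓘(ℝ, E) G)]

/-- The right side does not involve the metric; this is the source of the all-or-none alternative.
-/
theorem InvariantHermitianMetric.isSKT_iff_of_structureEq (h : InvariantHermitianMetric S)
    (hS : S.IsInducedBySMul) (hπ : IsLocalDiffeomorph 𝓘(ℝ, E) 𝓘(ℝ, E) ∞ (proj Γ))
    {b : Module.Basis (Fin 3) ℂ (GroupLieAlgebra 𝓘(ℝ, E) G)} {A B C D F : ℂ}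
    (hb : StructureEq b A B C D F) :
    h.IsSKT ↔ ‖A‖ ^ 2 + ‖D‖ ^ 2 + ‖F‖ ^ 2 + 2 * (conj B * C).re = 0 ∧
      ¬ (A = 0 ∧ B = 0 ∧ C = 0 ∧ D = 0 ∧ F = 0) := by
  have hg := h.isHermitianForm_lieForm hS hπ
  rw [h.isSKT_iff hS hπ, hb.dTorsion_eq_zero_iff hg, hb.dFund_eq_zero_iff hg]

theorem InvariantHermitianMetric.IsSKT.exists_structureEq {h : InvariantHermitianMetric S}
    (hh : h.IsSKT) (hM : IsNilmanifold E Γ)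
    (h3 : Module.finrank ℂ (GroupLieAlgebra 𝓘(ℝ, E) G) = 3) (hS : S.IsInducedBySMul) :
    ∃ (b : Module.Basis (Fin 3) ℂ (GroupLieAlgebra 𝓘(ℝ, E) G)) (A B C D F : ℂ),
      StructureEq b A B C D F := by
  have hπ := hM.localDiffeomorph
  have := hM.nilpotent
  have : Nonempty (OrbitSpace Γ) := ⟨proj Γ 1⟩
  have hN : IsIntegrableLie (GroupLieAlgebra 𝓘(ℝ, E) G) :=
    S.integrable.isIntegrableLie (isLieFrame_invFrame hπ) (hS.apply_invFrame hπ)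
  obtain ⟨p, hp0, hp, hIp, hL⟩ := exists_central_complex_line h3 hN
    (h.isHermitianForm_lieForm hS hπ) ((h.isSKT_iff hS hπ).1 hh).1
  exact exists_structureEq_of_central_complex_line h3 hN hp0 hp hIp hL

/-- Bases of invariant (1,0)-forms and complex bases of the Lie algebra correspond by duality. -/
theorem exists_basis_oneZeroForms_iff [FiniteDimensional ℂ (GroupLieAlgebra 𝓘(ℝ, E) G)]
    (hS : S.IsInducedBySMul) (hπ : IsLocalDiffeomorph 𝓘(ℝ, E) 𝓘(ℝ, E) ∞ (proj Γ))
    (A B C D F : ℂ) :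
    (∃ α : Module.Basis (Fin 3) ℂ S.oneZeroForms, extDer (α 0).1 = 0 ∧ extDer (α 1).1 = 0 ∧
      extDer (α 2).1 = A • wedge (conjForm (α 0).1) (α 1).1 +
        B • wedge (conjForm (α 1).1) (α 1).1 + C • wedge (α 0).1 (conjForm (α 0).1) +
        D • wedge (α 0).1 (conjForm (α 1).1) + F • wedge (α 0).1 (α 1).1) ↔
    ∃ b : Module.Basis (Fin 3) ℂ (GroupLieAlgebra 𝓘(ℝ, E) G), StructureEq b A B C D F := by
  have : Nonempty (OrbitSpace Γ) := ⟨proj Γ 1⟩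
  have hX := isLieFrame_invFrame hπ
  constructor
  · rintro ⟨α, hα⟩
    obtain ⟨b, hb⟩ := exists_basis_coord_eq (α.map (oneZeroFormsEquiv hS hπ))
    refine ⟨b, (extDer_basis_iff hX (α := fun i => (α i).1) (fun i m v => ?_) A B C D F).2 hα⟩
    rw [oneZeroFormsEquiv_apply hS hπ, hb, Module.Basis.map_apply]
  · rintro ⟨b, hb⟩
    let α := b.dualBasis.map (oneZeroFormsEquiv hS hπ).symm
    refine ⟨α, (extDer_basis_iff hX (α := fun i => (α i).1) (fun i m v => ?_) A B C D F).1 hb⟩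
    rw [oneZeroFormsEquiv_apply hS hπ, Module.Basis.map_apply, LinearEquiv.apply_symm_apply,
      Module.Basis.coe_dualBasis]

end Classification

end Nilmanifold

end

/-! ### The theorem -/

theorem mainTheorem1
    {G : Type*} [TopologicalSpace G] [ChartedSpace (EuclideanSpace ℝ (Fin 6)) G] [Group G]
    [LieGroup 𝓘(ℝ, EuclideanSpace ℝ (Fin 6)) ∞ G]
    (Γ : Subgroup G) [ChartedSpace (EuclideanSpace ℝ (Fin 6)) (Nilmanifold.OrbitSpace Γ)]
    [IsManifold 𝓘(ℝ, EuclideanSpace ℝ (Fin 6)) ∞ (Nilmanifold.OrbitSpace Γ)]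
    (hM : Nilmanifold.IsNilmanifold (EuclideanSpace ℝ (Fin 6)) Γ)
    (S : Nilmanifold.InvariantComplexStructure (EuclideanSpace ℝ (Fin 6)) Γ) :
    ((∀ g : Nilmanifold.InvariantHermitianMetric S, g.IsSKT) ∨
      (∀ g : Nilmanifold.InvariantHermitianMetric S, ¬ g.IsSKT)) ∧
    ((∃ g : Nilmanifold.InvariantHermitianMetric S, g.IsSKT) ↔
      ∃ (α : Module.Basis (Fin 3) ℂ S.oneZeroForms) (A B C D E : ℂ),
        Nilmanifold.extDer (α 0).1 = 0 ∧
        Nilmanifold.extDer (α 1).1 = 0 ∧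
        Nilmanifold.extDer (α 2).1 =
          A • Nilmanifold.wedge (Nilmanifold.conjForm (α 0).1) (α 1).1 +
          B • Nilmanifold.wedge (Nilmanifold.conjForm (α 1).1) (α 1).1 +
          C • Nilmanifold.wedge (α 0).1 (Nilmanifold.conjForm (α 0).1) +
          D • Nilmanifold.wedge (α 0).1 (Nilmanifold.conjForm (α 1).1) +
          E • Nilmanifold.wedge (α 0).1 (α 1).1 ∧
        ‖A‖ ^ 2 + ‖D‖ ^ 2 + ‖E‖ ^ 2 + 2 * (conj B * C).re = 0 ∧
        ¬ (A = 0 ∧ B = 0 ∧ C = 0 ∧ D = 0 ∧ E = 0)) := by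
  have hπ := hM.localDiffeomorph
  obtain ⟨_, _, hS⟩ := S.exists_isInducedBySMul hπ
  have h6 : Module.finrank ℝ
      (GroupLieAlgebra 𝓘(ℝ, EuclideanSpace ℝ (Fin 6)) G) = 6 :=
    finrank_euclideanSpace_fin (𝕜 := ℝ) (n := 6)
  have h3 : Module.finrank ℂ (GroupLieAlgebra 𝓘(ℝ, EuclideanSpace ℝ (Fin 6)) G) = 3 := by
    have h := Module.finrank_mul_finrank ℝ ℂ (GroupLieAlgebra 𝓘(ℝ, EuclideanSpace ℝ (Fin 6)) G)
    rw [Complex.finrank_real_complex, h6] at h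
    omega
  have : FiniteDimensional ℂ (GroupLieAlgebra 𝓘(ℝ, EuclideanSpace ℝ (Fin 6)) G) :=
    Module.finite_of_finrank_pos (by omega)
  constructor
  · by_cases h : ∃ g : Nilmanifold.InvariantHermitianMetric S, g.IsSKT
    · obtain ⟨g, hg⟩ := h
      obtain ⟨b, A, B, C, D, F, hb⟩ := hg.exists_structureEq hM h3 hS
      -- One SKT metric provides the structure equations, and these decide the question for every
      -- other metric.
      exact Or.inl fun g' => (g'.isSKT_iff_of_structureEq hS hπ hb).2
        ((g.isSKT_iff_of_structureEq hS hπ hb).1 hg)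
    · exact Or.inr (not_exists.1 h)
  · constructor
    · rintro ⟨g, hg⟩
      obtain ⟨b, A, B, C, D, F, hb⟩ := hg.exists_structureEq hM h3 hS
      obtain ⟨hK, h0⟩ := (g.isSKT_iff_of_structureEq hS hπ hb).1 hg
      obtain ⟨α, h₁, h₂, h₃⟩ :=
        (Nilmanifold.exists_basis_oneZeroForms_iff hS hπ A B C D F).2 ⟨b, hb⟩
      exact ⟨α, A, B, C, D, F, h₁, h₂, h₃, hK, h0⟩
    · rintro ⟨α, A, B, C, D, F, h₁, h₂, h₃, hK, h0⟩
      obtain ⟨b, hb⟩ :=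
        (Nilmanifold.exists_basis_oneZeroForms_iff hS hπ A B C D F).1 ⟨α, h₁, h₂, h₃⟩
      -- Any invariant Hermitian metric would do here; the one making b unitary shows that one
      -- exists.
      obtain ⟨g⟩ := Nilmanifold.exists_invariantHermitianMetric hS hπ
        (Nilmanifold.isHermitianForm_stdForm b)
      exact ⟨g, (g.isSKT_iff_of_structureEq hS hπ hb).2 ⟨hK, h0⟩⟩
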